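/- Let $n>p\ge 2$ and let $X_1,\dots,X_n$ be independent random vectors with the normal distribution $N_p(\theta,\Sigma)$, where the positive definite matrix $\Sigma$ is unknown. Let $C$ be either the positive orthant $\{\theta\in\mathbb R^p:\theta_i\ge 0 \text{ for all } i\}$ or the half-space $\{\theta\in\mathbb R^p:\theta_p\ge 0\}$, and consider testing $H_0:\theta=0$ against $H_1:\theta\in C\setminus\{0\}$. A test is a measurable function $\varphi:(\mathbb R^p)^n\to[0,1]$, where $\varphi(x)$ is the probability of rejecting $H_0$ at the data $x$. A test $\varphi$ is called a proper Bayes test if there are a probability measure $G$ on $\{(\theta,\Sigma):\theta\in C,\ \Sigma \text{ positive definite}\}$ and losses $a,b>0$ such that $\varphi$ minimizes, among all tests, the Bayes risk $$\int \Big( a\,\mathbf 1\{\theta=0\}\,E_{\theta,\Sigma}[\varphi]+b\,\mathbf 1\{\theta\neq 0\}\,E_{\theta,\Sigma}[1-\varphi]\Big)\,dG(\theta,\Sigma).$$ Then the likelihood ratio test (LRT) is not a proper Bayes test. That is, with $f(x;\theta,\Sigma)$ the joint density of the sample, for every critical value $k>1$ the test that rejects $H_0$ if and only if $$\frac{\sup_{\theta\in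 C,\ \Sigma}f(x;\theta,\Sigma)}{\sup_{\Sigma}f(x;0,\Sigma)}\ \ge\ k,$$ the suprema being over all positive definite $\Sigma$, is measurable and is not a proper Bayes test. (For $k\le 1$ the test always rejects, up to a null set, so the LRT of every size $\alpha\in(0,1)$ has $k>1$.) The same holds, for every $l>0$, for the test that rejects if and only if $L_n\ge l$, where $$1+L_n=\frac{1+n\bar X'S^{-1}\bar X}{1+\inf_{\theta\in C}n(\bar X-\theta)'S^{-1}(\bar X-\theta)},\qquad \bar X=\frac1n\sum_{i=1}^n X_i,\quad S=\frac1{n-1}\sum_{i=1}^n (X_i-\bar X)(X_i-\bar X)'.$$ (Replacing the divisor $n-1$ in $S$ by $1$ turns $(1+L_n)^{n/2}$ into the likelihood ratio above.) -/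

import Mathlib

open MeasureTheory
open scoped ENNReal NNReal Matrix

noncomputable section

namespace OrderRestricted

/-- A sample `x 0, …, x (n - 1)` of `n` vectors in `ℝ^p`. -/
abbrev Sample (n p : ℕ) : Type := Fin n → Fin p → ℝ

/-- A mean vector `θ` together with the entries of a dispersion matrix `Σ`. -/
abbrev Param (p : ℕ) : Type := (Fin p → ℝ) × (Fin p → Fin p → ℝ)

/-- The dispersion matrix of a parameter. -/
def disp {p : ℕ} (ω : Param p) : Matrix (Fin p) (Fin p) ℝ := Matrix.of ω.2

/-- The squared norm `v' A⁻¹ v` attached to a positive definite matrix `A`. -/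
def normSq {p : ℕ} (A : Matrix (Fin p) (Fin p) ℝ) (v : Fin p → ℝ) : ℝ :=
  v ⬝ᵥ (A⁻¹ *ᵥ v)

/-- The density of the normal distribution `N_p(θ, A)`, for `A` positive definite:
`((2π)^p |A|)^(-1/2) exp (-(v - θ)' A⁻¹ (v - θ) / 2)`. -/
def normalDensity {p : ℕ} (θ : Fin p → ℝ) (A : Matrix (Fin p) (Fin p) ℝ) (v : Fin p → ℝ) : ℝ :=
  (Real.sqrt ((2 * Real.pi) ^ p * A.det))⁻¹ * Real.exp (-(1 / 2) * normSq A (v - θ))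

/-- The likelihood: the joint density of `n` independent observations from `N_p(θ, A)`. -/
def likelihood {n p : ℕ} (θ : Fin p → ℝ) (A : Matrix (Fin p) (Fin p) ℝ) (x : Sample n p) : ℝ :=
  ∏ j, normalDensity θ A (x j)

/-- The joint law of `n` independent observations from `N_p(θ, A)`. -/
def sampleLaw (n : ℕ) {p : ℕ} (θ : Fin p → ℝ) (A : Matrix (Fin p) (Fin p) ℝ) :
    Measure (Sample n p) :=
  volume.withDensity (fun x => ENNReal.ofReal (likelihood θ A x))

/-- The positive orthant `{θ | θ ≥ 0}`. -/
def orthant (p : ℕ) : Set (Fin p → ℝ) := {θ | ∀ i, 0 ≤ θ i}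

/-- The half-space `{θ | θ_p ≥ 0}`, given by the sign of the last coordinate. -/
def halfSpace (p : ℕ) : Set (Fin p → ℝ) := {θ | ∀ i : Fin p, (i : ℕ) + 1 = p → 0 ≤ θ i}

/-- A (possibly randomized) test: `φ x` is the probability of rejecting `θ = 0` at the data `x`. -/
structure IsTest {n p : ℕ} (φ : Sample n p → ℝ≥0∞) : Prop where
  measurable : Measurable φ
  le_one : ∀ x, φ x ≤ 1

open Classical in
/-- The Bayes risk of the test `φ` of `θ = 0` against `θ ≠ 0` for the prior `G`, with loss `a` for
rejecting a true null hypothesis and loss `b` for accepting a false one. -/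
def averageRisk {n p : ℕ} (G : Measure (Param p)) (a b : ℝ≥0) (φ : Sample n p → ℝ≥0∞) : ℝ≥0∞ :=
  ∫⁻ ω, (if ω.1 = 0 then (a : ℝ≥0∞) * ∫⁻ x, φ x ∂(sampleLaw n ω.1 (disp ω))
    else (b : ℝ≥0∞) * ∫⁻ x, (1 - φ x) ∂(sampleLaw n ω.1 (disp ω))) ∂G

/-- `φ` is a proper Bayes test of `θ = 0` against `θ ∈ C \ {0}` with unknown dispersion matrix:
it minimizes the Bayes risk among all tests, for some prior that is a probability measure on the
parameter space `{(θ, Σ) | θ ∈ C, Σ positive definite}` and some positive losses. -/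
def IsProperBayes {n p : ℕ} (C : Set (Fin p → ℝ)) (φ : Sample n p → ℝ≥0∞) : Prop :=
  ∃ G : Measure (Param p), IsProbabilityMeasure G ∧ (∀ᵐ ω ∂G, ω.1 ∈ C ∧ (disp ω).PosDef) ∧
    ∃ a b : ℝ≥0, 0 < a ∧ 0 < b ∧
      ∀ ψ : Sample n p → ℝ≥0∞, IsTest ψ → averageRisk G a b φ ≤ averageRisk G a b ψ

/-- The supremum of the likelihood over `θ ∈ C` and all positive definite dispersion matrices. -/
def maxLikelihood {n p : ℕ} (C : Set (Fin p → ℝ)) (x : Sample n p) : ℝ≥0∞ :=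
  ⨆ θ ∈ C, ⨆ A : Matrix (Fin p) (Fin p) ℝ, ⨆ _ : A.PosDef, ENNReal.ofReal (likelihood θ A x)

/-- The likelihood ratio statistic for `θ = 0` against `θ ∈ C \ {0}`. -/
def likelihoodRatio {n p : ℕ} (C : Set (Fin p → ℝ)) (x : Sample n p) : ℝ≥0∞ :=
  maxLikelihood C x / maxLikelihood {0} x

open Classical in
/-- The likelihood ratio test: reject when the likelihood ratio is at least `k`. -/
def lrt {n p : ℕ} (C : Set (Fin p → ℝ)) (k : ℝ) (x : Sample n p) : ℝ≥0∞ :=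
  if ENNReal.ofReal k ≤ likelihoodRatio C x then 1 else 0

/-- The sample mean. -/
def sampleMean {n p : ℕ} (x : Sample n p) : Fin p → ℝ := (n : ℝ)⁻¹ • ∑ j, x j

/-- The sample covariance matrix, with divisor `n - 1`. -/
def sampleCov {n p : ℕ} (x : Sample n p) : Matrix (Fin p) (Fin p) ℝ :=
  ((n : ℝ) - 1)⁻¹ • ∑ j, Matrix.vecMulVec (x j - sampleMean x) (x j - sampleMean x)

/-- The statistic `L = ‖π(√n x̄)‖² / (1 + ‖√n x̄ - π(√n x̄)‖²)`, where `π` is the projection onto the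
closed convex cone `C` in the norm of the sample covariance matrix `S`; it is written through
`1 + L = (1 + n x̄' S⁻¹ x̄) / (1 + inf_{θ ∈ C} n (x̄ - θ)' S⁻¹ (x̄ - θ))`. -/
def statL {n p : ℕ} (C : Set (Fin p → ℝ)) (x : Sample n p) : ℝ :=
  (1 + n * normSq (sampleCov x) (sampleMean x)) /
    (1 + ⨅ θ : C, n * normSq (sampleCov x) (sampleMean x - θ)) - 1

open Classical in
/-- The test that rejects when the statistic `L` is at least `l`. -/
def testL {n p : ℕ} (C : Set (Fin p → ℝ)) (l : ℝ) (x : Sample n p) : ℝ≥0∞ :=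
  if l ≤ statL C x then 1 else 0

end OrderRestricted

end

/-!
Let `T₀ = ∑ x_j x_j'` and let `W` be the scatter matrix of the sample about its mean `x̄`. Both
statistics compare, up to a monotone transformation, `det T₀` with `det W` as long as `x̄ ∈ C`,
while for `x̄ ∉ C` the positive distance of `x̄` to `C` makes them strictly smaller
(`isRatioTest_lrt`, `isRatioTest_testL`). For the likelihood ratio this rests on the explicit maximum
of the likelihood over the dispersion matrix, a multiple of `(det T_θ)^(-n/2)` with `T_θ` the scatter
matrix about `θ` (`likelihood_le`, `likelihood_maximum`).

So over `C` the boundary of the rejection region is the hypersurface `det T₀ = κ det W`, and it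
leaves this hypersurface once `x̄` leaves `C`. The boundary for a Bayes test, on the other hand, is
an analytic hypersurface. If `F₀` and `F₁` are the mixtures of the likelihoods over the parts
of the prior on the null hypothesis and on the alternative, then a Bayes test rejects only where
`a F₀ ≤ b F₁` and accepts only where `b F₁ ≤ a F₀` (`ae_of_averageRisk_le`). Both mixtures are
continuous where `det W > 0`, because the maximized likelihood dominates them (`continuousAt_mix`),
so `a F₀ = b F₁` on the part of the hypersurface over the interior of `C` (`eq_of_isRatioTest`).

Restrict attention to samples with `T₀ = 1`. There `F₀` is constant, the hypersurface becomes a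
sphere of means `v = x̄`, and `F₁` is an integral of the exponentials `exp (n θ' Σ⁻¹ v)`. Along a
great circle this is analytic in the angle (`analyticAt_mix_circle`), so `a F₀ = b F₁` on the whole
circle, also at a point outside `C`. Near that point the test accepts, hence `b F₁ ≤ a F₀` with
equality at the point: `F₁` has a local maximum in `v`. Since exponentials are strictly convex, this
forces `θ = 0` almost everywhere on the alternative (`ae_eq_zero_of_eventually_le`). Hence `F₁ = 0`,
then `F₀ = 0`, and the prior vanishes.
-/

noncomputable section

namespace OrderRestricted

open Matrix Filter Topology

/-! ### Scatter matrices and the maximum of the likelihood -/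

/-- The scatter matrix `∑ (x_j - θ)(x_j - θ)'` of a sample about a point `θ`. -/
def scatterAbout {n p : ℕ} (θ : Fin p → ℝ) (x : Sample n p) : Matrix (Fin p) (Fin p) ℝ :=
  ∑ j, vecMulVec (x j - θ) (x j - θ)

/-- The scatter matrix of a sample about its mean. -/
def scatter {n p : ℕ} (x : Sample n p) : Matrix (Fin p) (Fin p) ℝ :=
  scatterAbout (sampleMean x) x

theorem scatterAbout_apply {n p : ℕ} (θ : Fin p → ℝ) (x : Sample n p) (i k : Fin p) :
    scatterAbout θ x i k = ∑ j, (x j i - θ i) * (x j k - θ k) := by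
  simp [scatterAbout, Matrix.sum_apply, vecMulVec_apply]

theorem sampleMean_apply {n p : ℕ} (x : Sample n p) (i : Fin p) :
    sampleMean x i = (n : ℝ)⁻¹ * ∑ j, x j i := by
  simp [sampleMean]

theorem sampleCov_eq {n p : ℕ} (x : Sample n p) :
    sampleCov x = ((n : ℝ) - 1)⁻¹ • scatter x := rfl

theorem posSemidef_scatterAbout {n p : ℕ} (θ : Fin p → ℝ) (x : Sample n p) :
    (scatterAbout θ x).PosSemidef :=
  posSemidef_sum _ fun j _ => by
    simpa using posSemidef_vecMulVec_self_star (x j - θ)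

theorem scatterAbout_eq_scatter_add {n p : ℕ} (hn : n ≠ 0) (θ : Fin p → ℝ) (x : Sample n p) :
    scatterAbout θ x =
      scatter x + (n : ℝ) • vecMulVec (sampleMean x - θ) (sampleMean x - θ) := by
  ext i k
  have hn' : (n : ℝ) ≠ 0 := Nat.cast_ne_zero.2 hn
  have h (i : Fin p) : ∑ j, x j i = n * sampleMean x i := by
    rw [sampleMean_apply]; field_simp
  simp only [scatter, Matrix.add_apply, Matrix.smul_apply, scatterAbout_apply, vecMulVec_apply,
    Pi.sub_apply, smul_eq_mul, sub_mul, mul_sub, Finset.sum_sub_distrib, ← Finset.mul_sum,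
    ← Finset.sum_mul, h, Finset.sum_const, Finset.card_univ, Fintype.card_fin, nsmul_eq_mul]
  ring

theorem det_add_smul_vecMulVec {p : ℕ} {A : Matrix (Fin p) (Fin p) ℝ} (hA : A.det ≠ 0) (c : ℝ)
    (u : Fin p → ℝ) : (A + c • vecMulVec u u).det = A.det * (1 + c * normSq A u) := by
  have := det_add_replicateCol_mul_replicateRow (ι := Unit) (isUnit_iff_ne_zero.2 hA) (c • u) u
  rw [← vecMulVec_eq] at this
  rw [← smul_vecMulVec, this, Matrix.mul_assoc, det_unique (n := Unit)]
  simp [Matrix.mul_apply, normSq, dotProduct, mulVec, Finset.mul_sum]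

theorem det_scatterAbout {n p : ℕ} (hn : n ≠ 0) (θ : Fin p → ℝ) {x : Sample n p}
    (hx : 0 < (scatter x).det) : (scatterAbout θ x).det =
      (scatter x).det * (1 + n * normSq (scatter x) (sampleMean x - θ)) := by
  rw [scatterAbout_eq_scatter_add hn, det_add_smul_vecMulVec hx.ne']

theorem normSq_nonneg {p : ℕ} {A : Matrix (Fin p) (Fin p) ℝ} (hA : A.PosSemidef) (u : Fin p → ℝ) :
    0 ≤ normSq A u := by
  simpa [normSq] using hA.inv.dotProduct_mulVec_nonneg u

theorem det_scatter_le_det_scatterAbout {n p : ℕ} (hn : n ≠ 0) (θ : Fin p → ℝ) {x : Sample n p}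
    (hx : 0 < (scatter x).det) : (scatter x).det ≤ (scatterAbout θ x).det := by
  rw [det_scatterAbout hn θ hx]
  have := normSq_nonneg (posSemidef_scatterAbout (sampleMean x) x) (sampleMean x - θ)
  exact le_mul_of_one_le_right hx.le (le_add_of_nonneg_right (by positivity))

theorem sum_normSq_eq_trace {n p : ℕ} (A : Matrix (Fin p) (Fin p) ℝ) (θ : Fin p → ℝ)
    (x : Sample n p) : ∑ j, normSq A (x j - θ) = (A⁻¹ * scatterAbout θ x).trace := by
  simp only [scatterAbout, Matrix.mul_sum, trace_sum, mul_vecMulVec, trace_vecMulVec, normSq]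
  exact Finset.sum_congr rfl fun j _ => dotProduct_comm _ _

theorem likelihood_eq {n p : ℕ} (θ : Fin p → ℝ) (A : Matrix (Fin p) (Fin p) ℝ) (x : Sample n p) :
    likelihood θ A x = (Real.sqrt ((2 * Real.pi) ^ p * A.det))⁻¹ ^ n *
      Real.exp (-(1 / 2) * (A⁻¹ * scatterAbout θ x).trace) := by
  simp only [likelihood, normalDensity, Finset.prod_mul_distrib, Finset.prod_const,
    Finset.card_univ, Fintype.card_fin, ← Real.exp_sum, ← Finset.mul_sum, sum_normSq_eq_trace]

open scoped MatrixOrder in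
/-- Applied to `A = Σ⁻¹` and `T = S / n`, this is the inequality that identifies the maximum
likelihood estimator of a dispersion matrix. -/
theorem det_mul_det_le_exp_trace {p : ℕ} {A T : Matrix (Fin p) (Fin p) ℝ} (hA : A.PosSemidef)
    (hT : T.PosSemidef) : A.det * T.det ≤ Real.exp ((A * T).trace - p) := by
  obtain ⟨R, rfl⟩ := CStarAlgebra.nonneg_iff_eq_star_mul_self.1 hT.nonneg
  rw [star_eq_conjTranspose]
  have hB : (R * A * Rᴴ).PosSemidef := hA.mul_mul_conjTranspose_same R
  have h1 : A.det * (Rᴴ * R).det = (R * A * Rᴴ).det := by simp only [det_mul]; ring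
  have h2 : (A * (Rᴴ * R)).trace = (R * A * Rᴴ).trace := by
    rw [← Matrix.mul_assoc, trace_mul_comm, ← Matrix.mul_assoc]
  rw [h1, h2, hB.1.det_eq_prod_eigenvalues, hB.1.trace_eq_sum_eigenvalues]
  have : ∑ i, (hB.1.eigenvalues i : ℝ) - p = ∑ i, (hB.1.eigenvalues i - 1) := by
    simp [Finset.sum_sub_distrib]
  simp only [RCLike.ofReal_real_eq_id, id_eq]
  rw [this, Real.exp_sum]
  refine Finset.prod_le_prod (fun i _ => hB.eigenvalues_nonneg i) fun i _ => ?_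
  have := Real.add_one_le_exp (hB.1.eigenvalues i - 1)
  linarith

/-- The factor of the maximized likelihood that does not depend on the data. -/
def peak (n p : ℕ) : ℝ :=
  (Real.sqrt ((2 * Real.pi / n) ^ p))⁻¹ ^ n * Real.exp (-(n * p / 2))

theorem peak_pos {n : ℕ} (p : ℕ) (hn : n ≠ 0) : 0 < peak n p := by
  have : (0 : ℝ) < n := by exact_mod_cast Nat.pos_of_ne_zero hn
  have := Real.pi_pos
  unfold peak
  positivity

/-- The upper bound for the likelihood over all dispersion matrices, attained at
`scatterAbout θ x / n` by `likelihood_maximum`. -/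
theorem likelihood_le {n p : ℕ} (hn : n ≠ 0) (θ : Fin p → ℝ) {A : Matrix (Fin p) (Fin p) ℝ}
    (hA : A.PosDef) {x : Sample n p} (hx : 0 < (scatterAbout θ x).det) :
    likelihood θ A x ≤ peak n p * (Real.sqrt (scatterAbout θ x).det)⁻¹ ^ n := by
  have hn' : (0 : ℝ) < n := by exact_mod_cast Nat.pos_of_ne_zero hn
  have hpi := Real.pi_pos
  have hd := hA.det_pos
  set t := (A⁻¹ * scatterAbout θ x).trace with ht
  have key := det_mul_det_le_exp_trace hA.inv.posSemidef
    ((posSemidef_scatterAbout θ x).smul (inv_nonneg.2 hn'.le))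
  rw [Matrix.mul_smul, trace_smul, smul_eq_mul, ← ht, det_smul, Fintype.card_fin,
    det_nonsing_inv, Ring.inverse_eq_inv'] at key
  have h1 : ((2 * Real.pi) ^ p * A.det)⁻¹ ≤
      ((2 * Real.pi / n) ^ p)⁻¹ * ((scatterAbout θ x).det)⁻¹ * Real.exp ((n : ℝ)⁻¹ * t - p) := by
    calc ((2 * Real.pi) ^ p * A.det)⁻¹
        = ((2 * Real.pi / n) ^ p)⁻¹ * ((scatterAbout θ x).det)⁻¹ *
          ((A.det)⁻¹ * ((n : ℝ)⁻¹ ^ p * (scatterAbout θ x).det)) := by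
          rw [div_pow, inv_pow]; field_simp
      _ ≤ _ := by gcongr
  have h2 := pow_le_pow_left₀ (Real.sqrt_nonneg _) (Real.sqrt_le_sqrt h1) n
  rw [Real.sqrt_mul (by positivity), Real.sqrt_mul (by positivity), Real.sqrt_inv, Real.sqrt_inv,
    Real.sqrt_inv, mul_pow _ (Real.sqrt (Real.exp _)), ← Real.exp_half, ← Real.exp_nat_mul] at h2
  rw [likelihood_eq, ← ht]
  refine (mul_le_mul_of_nonneg_right h2 (Real.exp_pos _).le).trans_eq ?_
  rw [mul_assoc, ← Real.exp_add]
  have : n * (((n : ℝ)⁻¹ * t - p) / 2) + -(1 / 2) * t = -(n * p / 2) := by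
    field_simp; ring
  rw [this]; unfold peak; ring

theorem likelihood_maximum {n p : ℕ} (hn : n ≠ 0) (θ : Fin p → ℝ) {x : Sample n p}
    (hx : 0 < (scatterAbout θ x).det) : ((n : ℝ)⁻¹ • scatterAbout θ x).PosDef ∧
    likelihood θ ((n : ℝ)⁻¹ • scatterAbout θ x) x =
      peak n p * (Real.sqrt (scatterAbout θ x).det)⁻¹ ^ n := by
  have hn' : (0 : ℝ) < n := by exact_mod_cast Nat.pos_of_ne_zero hn
  have hpi := Real.pi_pos
  refine ⟨((posSemidef_scatterAbout θ x).posDef_iff_det_ne_zero.2 hx.ne').smul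
    (inv_pos.2 hn'), ?_⟩
  have hu : IsUnit (scatterAbout θ x).det := isUnit_iff_ne_zero.2 hx.ne'
  have hinv : ((n : ℝ)⁻¹ • scatterAbout θ x)⁻¹ = (n : ℝ) • (scatterAbout θ x)⁻¹ := by
    have := inv_smul' (scatterAbout θ x) (Units.mk0 (n : ℝ)⁻¹ (inv_ne_zero hn'.ne')) hu
    simpa [Units.smul_def] using this
  rw [likelihood_eq, hinv, Matrix.smul_mul, nonsing_inv_mul _ hu, trace_smul, trace_one, det_smul,
    Fintype.card_fin, peak, ← mul_assoc, Real.sqrt_mul (by positivity), ← mul_pow, mul_inv,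
    mul_pow, smul_eq_mul, mul_right_comm, ← div_eq_mul_inv]
  congr 3
  ring

theorem likelihood_nonneg {n p : ℕ} (θ : Fin p → ℝ) (A : Matrix (Fin p) (Fin p) ℝ)
    (x : Sample n p) : 0 ≤ likelihood θ A x := by
  rw [likelihood_eq]; positivity

theorem likelihood_pos {n p : ℕ} (θ : Fin p → ℝ) {A : Matrix (Fin p) (Fin p) ℝ} (hA : A.PosDef)
    (x : Sample n p) : 0 < likelihood θ A x := by
  have := hA.det_pos
  have := Real.pi_pos
  rw [likelihood_eq]; positivity

/-! ### Continuity and measurability -/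

theorem continuous_sampleMean {n p : ℕ} : Continuous (sampleMean : Sample n p → Fin p → ℝ) := by
  unfold sampleMean; fun_prop

theorem continuous_scatterAbout {n p : ℕ} (θ : Fin p → ℝ) :
    Continuous (scatterAbout θ : Sample n p → Matrix (Fin p) (Fin p) ℝ) := by
  refine continuous_matrix fun i k => ?_
  simp only [scatterAbout_apply]
  fun_prop

theorem continuous_scatter {n p : ℕ} :
    Continuous (scatter : Sample n p → Matrix (Fin p) (Fin p) ℝ) := by
  refine continuous_matrix fun i k => ?_
  simp only [scatter, scatterAbout_apply]
  have := continuous_sampleMean (n := n) (p := p)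
  fun_prop

theorem measurable_det {α : Type*} [MeasurableSpace α] {p : ℕ} {A : α → Fin p → Fin p → ℝ}
    (hA : Measurable A) : Measurable fun y => (Matrix.of (A y)).det := by
  have : Continuous fun B : Fin p → Fin p → ℝ => (Matrix.of B).det :=
    Continuous.matrix_det (continuous_id (X := Matrix (Fin p) (Fin p) ℝ))
  exact this.measurable.comp hA

theorem measurable_inv_apply {α : Type*} [MeasurableSpace α] {p : ℕ} {A : α → Fin p → Fin p → ℝ}
    (hA : Measurable A) (i k : Fin p) : Measurable fun y => (Matrix.of (A y))⁻¹ i k := by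
  have hdet := measurable_det hA
  have : Continuous fun B : Fin p → Fin p → ℝ => (Matrix.of B).adjugate i k :=
    (Continuous.matrix_adjugate (continuous_id (X := Matrix (Fin p) (Fin p) ℝ))).matrix_elem i k
  have hadj : Measurable fun y => (Matrix.of (A y)).adjugate i k := this.measurable.comp hA
  simp only [Matrix.inv_def, Ring.inverse_eq_inv', Matrix.smul_apply, smul_eq_mul]
  fun_prop

theorem measurable_normSq {α : Type*} [MeasurableSpace α] {p : ℕ}
    {A : α → Fin p → Fin p → ℝ} {v : α → Fin p → ℝ} (hA : Measurable A) (hv : Measurable v) :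
    Measurable fun y => normSq (Matrix.of (A y)) (v y) := by
  have hinv := measurable_inv_apply hA
  have hv' (i : Fin p) : Measurable fun y => v y i := (measurable_pi_apply i).comp hv
  simp only [normSq, dotProduct, mulVec]
  exact Finset.measurable_sum _ fun i _ => (hv' i).mul
    (Finset.measurable_sum _ fun k _ => (hinv i k).mul (hv' k))

theorem continuous_normSq {p : ℕ} (A : Matrix (Fin p) (Fin p) ℝ) : Continuous (normSq A) := by
  unfold normSq; fun_prop

theorem measurable_likelihood {n p : ℕ} :
    Measurable fun q : Param p × Sample n p => likelihood q.1.1 (disp q.1) q.2 := by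
  have hdet : Measurable fun q : Param p × Sample n p => (disp q.1).det :=
    measurable_det (by fun_prop)
  have hq (j : Fin n) :
      Measurable fun q : Param p × Sample n p => normSq (disp q.1) (q.2 j - q.1.1) :=
    measurable_normSq (by fun_prop) (by fun_prop)
  simp only [likelihood, normalDensity]
  fun_prop

theorem continuous_likelihood {n p : ℕ} (θ : Fin p → ℝ) (A : Matrix (Fin p) (Fin p) ℝ) :
    Continuous (likelihood θ A : Sample n p → ℝ) := by
  have := continuous_normSq A
  unfold likelihood normalDensity
  fun_prop

theorem measurable_maxLikelihood {n p : ℕ} (C : Set (Fin p → ℝ)) :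
    Measurable (maxLikelihood C : Sample n p → ℝ≥0∞) := by
  -- a supremum of continuous functions, so no countable subfamily is needed
  refine LowerSemicontinuous.measurable ?_
  unfold maxLikelihood
  refine lowerSemicontinuous_iSup fun θ => lowerSemicontinuous_iSup fun _ =>
    lowerSemicontinuous_iSup fun A => lowerSemicontinuous_iSup fun _ => ?_
  exact (ENNReal.continuous_ofReal.comp (continuous_likelihood θ A)).lowerSemicontinuous

theorem isTest_lrt {n p : ℕ} (C : Set (Fin p → ℝ)) (k : ℝ) : IsTest (lrt (n := n) C k) where
  measurable := by
    refine Measurable.ite (measurableSet_le measurable_const ?_) measurable_const measurable_const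
    exact (measurable_maxLikelihood C).div (measurable_maxLikelihood {0})
  le_one x := by unfold lrt; split_ifs <;> simp

theorem measurable_statL {n p : ℕ} (C : Set (Fin p → ℝ)) :
    Measurable (statL C : Sample n p → ℝ) := by
  have hm (θ : Fin p → ℝ) :
      Measurable fun x : Sample n p => normSq (sampleCov x) (sampleMean x - θ) := by
    refine measurable_normSq (A := fun x : Sample n p => sampleCov x) ?_
      (by have := continuous_sampleMean (n := n) (p := p); fun_prop)
    refine measurable_pi_lambda _ fun i => measurable_pi_lambda _ fun k => ?_
    simp only [sampleCov_eq, Matrix.smul_apply, smul_eq_mul]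
    exact (continuous_scatter.matrix_elem i k).measurable.const_mul _
  -- the infimum over `C` is an infimum over a countable dense subset
  obtain ⟨D, hDc, hD⟩ := TopologicalSpace.exists_countable_dense C
  have := hDc.to_subtype
  have hinf (x : Sample n p) : ⨅ θ : C, n * normSq (sampleCov x) (sampleMean x - θ) =
      ⨅ θ : D, n * normSq (sampleCov x) (sampleMean x - (θ : C)) := by
    refine (hD.ciInf' (f := fun θ : C => n * normSq (sampleCov x) (sampleMean x - θ)) ?_).symm
    have := continuous_normSq (sampleCov x)
    fun_prop
  have h0 : Measurable fun x : Sample n p => normSq (sampleCov x) (sampleMean x) := by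
    simpa using hm 0
  unfold statL
  simp only [hinf]
  exact ((measurable_const.add (h0.const_mul _)).div
    (measurable_const.add (Measurable.iInf fun θ => (hm _).const_mul _))).sub_const _

theorem isTest_testL {n p : ℕ} (C : Set (Fin p → ℝ)) (l : ℝ) : IsTest (testL (n := n) C l) where
  measurable := Measurable.ite (measurableSet_le measurable_const (measurable_statL C))
    measurable_const measurable_const
  le_one x := by unfold testL; split_ifs <;> simp

/-! ### The rejection regions of the two tests -/

/-- The cone cut out by the sign constraints `0 ≤ θ i` for `i ∈ I`. -/
def signCone {p : ℕ} (I : Set (Fin p)) : Set (Fin p → ℝ) := {θ | ∀ i ∈ I, 0 ≤ θ i}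

/-- A test whose rejection region has the boundary `det T₀ = κ * det W` over `C`, where `T₀` and `W`
are the scatter matrices about `0` and about the mean, and which accepts near the part of that
hypersurface where the mean lies outside `C`. -/
structure IsRatioTest {n p : ℕ} (C : Set (Fin p → ℝ)) (κ : ℝ) (φ : Sample n p → ℝ≥0∞) : Prop where
  reject : ∀ x, 0 < (scatter x).det → sampleMean x ∈ C →
    κ * (scatter x).det ≤ (scatterAbout 0 x).det → φ x = 1
  accept : ∀ x, 0 < (scatter x).det → (scatterAbout 0 x).det < κ * (scatter x).det → φ x = 0
  accept_outside : ∀ x, 0 < (scatter x).det → sampleMean x ∉ C →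
    (scatterAbout 0 x).det = κ * (scatter x).det → ∀ᶠ y in 𝓝 x, φ y = 0

/-- The Cauchy–Schwarz inequality for `u i = (A e_i)' A⁻¹ u` in the norm of `A`. -/
theorem sq_le_mul_normSq {p : ℕ} {A : Matrix (Fin p) (Fin p) ℝ} (hA : A.PosDef) (u : Fin p → ℝ)
    (i : Fin p) : u i ^ 2 ≤ A i i * normSq A u := by
  have hAA : A *ᵥ (A⁻¹ *ᵥ u) = u := by
    rw [mulVec_mulVec, mul_nonsing_inv _ (isUnit_iff_ne_zero.2 hA.det_pos.ne'), one_mulVec]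
  have hii := hA.diag_pos (i := i)
  have hsym : Aᵀ = A := by simpa using hA.isHermitian.eq
  have h := hA.posSemidef.dotProduct_mulVec_nonneg (A⁻¹ *ᵥ u - (u i / A i i) • Pi.single i 1)
  have h1 : Pi.single i 1 ⬝ᵥ u = u i := by simp
  have h2 : (A⁻¹ *ᵥ u) ⬝ᵥ (A *ᵥ Pi.single i 1) = u i := by
    rw [dotProduct_mulVec, ← mulVec_transpose, hsym, hAA]; simp
  have h3 : Pi.single i 1 ⬝ᵥ (A *ᵥ Pi.single i 1) = A i i := by simp
  have h4 : (A⁻¹ *ᵥ u) ⬝ᵥ u = normSq A u := dotProduct_comm _ _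
  rw [star_trivial, mulVec_sub, mulVec_smul, hAA, sub_dotProduct, dotProduct_sub, dotProduct_sub,
    smul_dotProduct, smul_dotProduct, dotProduct_smul, dotProduct_smul, h1, h2, h3, h4] at h
  simp only [smul_eq_mul] at h
  have : normSq A u - u i ^ 2 / A i i ≥ 0 := by
    have e : u i / A i i * A i i = u i := div_mul_cancel₀ _ hii.ne'
    have e' : u i ^ 2 / A i i = u i / A i i * u i := by ring
    rw [e] at h
    rw [e']
    linarith
  rw [ge_iff_le, sub_nonneg, div_le_iff₀ hii] at this
  linarith

theorem posDef_scatter {n p : ℕ} {x : Sample n p} (hx : 0 < (scatter x).det) :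
    (scatter x).PosDef :=
  (posSemidef_scatterAbout _ x).posDef_iff_det_ne_zero.2 hx.ne'

theorem eventually_det_scatter_pos {n p : ℕ} {x : Sample n p} (hx : 0 < (scatter x).det) :
    ∀ᶠ y in 𝓝 x, 0 < (scatter y).det :=
  (continuous_scatter.matrix_det.continuousAt).eventually (lt_mem_nhds hx)

/-- If the mean violates a sign constraint, then the distance of the mean to the cone is bounded
below, near the given sample, by a positive continuous function. -/
theorem exists_lower_bound_of_notMem {n p : ℕ} (hn : n ≠ 0) {I : Set (Fin p)} {x : Sample n p}
    (hx : 0 < (scatter x).det) (hxC : sampleMean x ∉ signCone I) :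
    ∃ E : Sample n p → ℝ, ContinuousAt E x ∧ 0 < E x ∧ ∀ᶠ y in 𝓝 x, 0 ≤ E y ∧
      ∀ θ ∈ signCone I, E y ≤ n * normSq (scatter y) (sampleMean y - θ) := by
  have hn' : (0 : ℝ) < n := by exact_mod_cast Nat.pos_of_ne_zero hn
  simp only [signCone, Set.mem_ofPred_eq, not_forall, not_le] at hxC
  obtain ⟨i, hi, hxi⟩ := hxC
  have hpos {y : Sample n p} (hy : 0 < (scatter y).det) : 0 < scatter y i i :=
    (posDef_scatter hy).diag_pos
  have hmean : Continuous fun y : Sample n p => sampleMean y i :=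
    (continuous_apply i).comp continuous_sampleMean
  refine ⟨fun y => n * (sampleMean y i ^ 2 / scatter y i i), ?_, ?_, ?_⟩
  · exact continuousAt_const.mul ((hmean.pow 2).continuousAt.div
      (continuous_scatter.matrix_elem i i).continuousAt (hpos hx).ne')
  · have := hpos hx
    have := sq_pos_of_neg hxi
    positivity
  · filter_upwards [eventually_det_scatter_pos hx, hmean.continuousAt.eventually (gt_mem_nhds hxi)]
      with y hy hyi
    have hd := hpos hy
    refine ⟨by positivity, fun θ hθ => mul_le_mul_of_nonneg_left ?_ hn'.le⟩
    rw [div_le_iff₀ hd, mul_comm]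
    refine le_trans ?_ (sq_le_mul_normSq (posDef_scatter hy) (sampleMean y - θ) i)
    have := hθ i hi
    rw [Pi.sub_apply]
    nlinarith

theorem maxLikelihood_le {n p : ℕ} (hn : n ≠ 0) {C : Set (Fin p → ℝ)} {x : Sample n p} {D : ℝ}
    (hD : 0 < D) (h : ∀ θ ∈ C, D ≤ (scatterAbout θ x).det) :
    maxLikelihood C x ≤ ENNReal.ofReal (peak n p * (Real.sqrt D)⁻¹ ^ n) := by
  have hpeak := peak_pos p hn
  refine iSup₂_le fun θ hθ => iSup₂_le fun A hA => ENNReal.ofReal_le_ofReal ?_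
  have hDθ := h θ hθ
  refine (likelihood_le hn θ hA (hD.trans_le hDθ)).trans ?_
  have := Real.sqrt_pos.2 hD
  gcongr

theorem le_maxLikelihood {n p : ℕ} (hn : n ≠ 0) {C : Set (Fin p → ℝ)} {x : Sample n p}
    {θ : Fin p → ℝ} (hθ : θ ∈ C) (hx : 0 < (scatterAbout θ x).det) :
    ENNReal.ofReal (peak n p * (Real.sqrt (scatterAbout θ x).det)⁻¹ ^ n) ≤ maxLikelihood C x := by
  obtain ⟨hA, h⟩ := likelihood_maximum hn θ hx
  rw [← h]
  exact le_iSup₂_of_le θ hθ (le_iSup₂_of_le _ hA le_rfl)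

theorem maxLikelihood_zero {n p : ℕ} (hn : n ≠ 0) {x : Sample n p}
    (hx : 0 < (scatterAbout 0 x).det) : maxLikelihood {0} x =
      ENNReal.ofReal (peak n p * (Real.sqrt (scatterAbout 0 x).det)⁻¹ ^ n) :=
  le_antisymm (maxLikelihood_le hn hx (by rintro θ rfl; exact le_rfl)) (le_maxLikelihood hn rfl hx)

theorem lrt_eq_one {n p : ℕ} (hn : n ≠ 0) {C : Set (Fin p → ℝ)} {x : Sample n p} {s : ℝ}
    (hs : 0 < s) {θ : Fin p → ℝ} (hθ : θ ∈ C) (hx : 0 < (scatterAbout θ x).det)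
    (h : s ^ 2 * (scatterAbout θ x).det ≤ (scatterAbout 0 x).det) : lrt C (s ^ n) x = 1 := by
  have hpeak := peak_pos p hn
  have h0 : 0 < (scatterAbout 0 x).det := lt_of_lt_of_le (by positivity) h
  have hr0 := Real.sqrt_pos.2 h0
  have hr := Real.sqrt_pos.2 hx
  refine if_pos ?_
  rw [likelihoodRatio, maxLikelihood_zero hn h0, ENNReal.le_div_iff_mul_le
    (Or.inl (ENNReal.ofReal_pos.2 (by positivity)).ne') (Or.inl ENNReal.ofReal_ne_top),
    ← ENNReal.ofReal_mul (by positivity)]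
  refine le_trans (ENNReal.ofReal_le_ofReal ?_) (le_maxLikelihood hn hθ hx)
  have h1 : s * Real.sqrt (scatterAbout θ x).det ≤ Real.sqrt (scatterAbout 0 x).det := by
    refine Real.le_sqrt_of_sq_le ?_
    rwa [mul_pow, Real.sq_sqrt hx.le]
  calc s ^ n * (peak n p * (Real.sqrt (scatterAbout 0 x).det)⁻¹ ^ n)
      = peak n p * (s / Real.sqrt (scatterAbout 0 x).det) ^ n := by
        rw [div_eq_mul_inv, mul_pow]; ring
    _ ≤ _ := by
        gcongr
        rw [div_le_iff₀ hr0, ← div_eq_inv_mul, le_div_iff₀ hr]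
        exact h1

theorem lrt_eq_zero {n p : ℕ} (hn : n ≠ 0) {C : Set (Fin p → ℝ)} {x : Sample n p} {s D : ℝ}
    (hs : 0 < s) (hD : 0 < D) (hC : ∀ θ ∈ C, D ≤ (scatterAbout θ x).det)
    (h0 : 0 < (scatterAbout 0 x).det) (h : (scatterAbout 0 x).det < s ^ 2 * D) :
    lrt C (s ^ n) x = 0 := by
  have hpeak := peak_pos p hn
  have hr0 := Real.sqrt_pos.2 h0
  have hr := Real.sqrt_pos.2 hD
  refine if_neg ?_
  rw [not_le, likelihoodRatio, maxLikelihood_zero hn h0]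
  refine ENNReal.div_lt_of_lt_mul ?_
  rw [← ENNReal.ofReal_mul (by positivity)]
  refine (maxLikelihood_le hn hD hC).trans_lt ((ENNReal.ofReal_lt_ofReal_iff (by positivity)).2 ?_)
  have h1 : Real.sqrt (scatterAbout 0 x).det < s * Real.sqrt D := by
    rw [Real.sqrt_lt' (by positivity), mul_pow, Real.sq_sqrt hD.le]
    exact h
  calc peak n p * (Real.sqrt D)⁻¹ ^ n
      < peak n p * (s / Real.sqrt (scatterAbout 0 x).det) ^ n := by
        gcongr
        rw [lt_div_iff₀ hr0, ← div_eq_inv_mul, div_lt_iff₀ hr]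
        exact h1
    _ = _ := by
        rw [div_eq_mul_inv, mul_pow]; ring

/-- The likelihood ratio test at the critical value `k` is a ratio test with `κ = k^(2/n)`. -/
theorem isRatioTest_lrt {n p : ℕ} (hn : n ≠ 0) (I : Set (Fin p)) {k : ℝ} (hk : 1 < k) :
    ∃ κ, 1 < κ ∧ IsRatioTest (signCone I) κ (lrt (n := n) (signCone I) k) := by
  have hk0 : 0 ≤ k := by linarith
  obtain ⟨s, hs0, rfl⟩ : ∃ s : ℝ, 0 ≤ s ∧ s ^ n = k :=
    ⟨k ^ ((n : ℝ)⁻¹), by positivity, Real.rpow_inv_natCast_pow hk0 hn⟩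
  have hs1 : 1 < s := (one_lt_pow_iff_of_nonneg hs0 hn).1 hk
  have hs : 0 < s := by linarith
  refine ⟨s ^ 2, one_lt_pow₀ hs1 two_ne_zero, ⟨fun x hx hxC h => ?_, fun x hx h => ?_,
    fun x hx hxC h => ?_⟩⟩
  · exact lrt_eq_one hn hs hxC hx h
  · exact lrt_eq_zero hn hs hx (fun θ _ => det_scatter_le_det_scatterAbout hn θ hx)
      (hx.trans_le (det_scatter_le_det_scatterAbout hn 0 hx)) h
  · obtain ⟨E, hEc, hE0, hE⟩ := exists_lower_bound_of_notMem hn hx hxC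
    have hlt : (scatterAbout 0 x).det < s ^ 2 * ((scatter x).det * (1 + E x)) := by
      rw [h, ← mul_assoc]
      exact lt_mul_of_one_lt_right (by positivity) (by linarith)
    have hc : ContinuousAt (fun y : Sample n p => s ^ 2 * ((scatter y).det * (1 + E y))) x :=
      continuousAt_const.mul (continuous_scatter.matrix_det.continuousAt.mul
        (continuousAt_const.add hEc))
    have hc0 := (continuous_scatterAbout (n := n) (p := p) 0).matrix_det.continuousAt (x := x)
    filter_upwards [hE, eventually_det_scatter_pos hx, hc0.eventually_lt hc hlt] with y hEy hy hlt'
    refine lrt_eq_zero hn hs (D := (scatter y).det * (1 + E y)) ?_ (fun θ hθ => ?_)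
      (hy.trans_le (det_scatter_le_det_scatterAbout hn 0 hy)) hlt'
    · have := hEy.1
      positivity
    · rw [det_scatterAbout hn θ hy]
      have := hEy.2 θ hθ
      gcongr

theorem normSq_sampleCov {n p : ℕ} (hn : 1 < n) {x : Sample n p} (hx : 0 < (scatter x).det)
    (u : Fin p → ℝ) : normSq (sampleCov x) u = (n - 1) * normSq (scatter x) u := by
  have hn' : ((n : ℝ) - 1) ≠ 0 := by
    have : (1 : ℝ) < n := by exact_mod_cast hn
    linarith
  have hinv : (((n : ℝ) - 1)⁻¹ • scatter x)⁻¹ = ((n : ℝ) - 1) • (scatter x)⁻¹ := by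
    have := inv_smul' (scatter x) (Units.mk0 ((n : ℝ) - 1)⁻¹ (inv_ne_zero hn'))
      (isUnit_iff_ne_zero.2 hx.ne')
    simpa [Units.smul_def] using this
  rw [sampleCov_eq, normSq, hinv, smul_mulVec, dotProduct_smul, smul_eq_mul, normSq]

theorem statL_lt {n p : ℕ} (hn : 1 < n) {C : Set (Fin p → ℝ)} (hC : C.Nonempty) {x : Sample n p}
    (hx : 0 < (scatter x).det) {l E : ℝ} (hE : 0 ≤ E) (hl : 0 < l)
    (h : ∀ θ ∈ C, E ≤ n * normSq (scatter x) (sampleMean x - θ))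
    (hlt : 1 + (n - 1) * ((scatterAbout 0 x).det / (scatter x).det - 1) <
      (1 + l) * (1 + (n - 1) * E)) : statL C x < l := by
  have hn' : (0 : ℝ) < n - 1 := by
    have : (1 : ℝ) < n := by exact_mod_cast hn
    linarith
  have := hC.to_subtype
  have hinf : (n - 1) * E ≤ ⨅ θ : C, n * normSq (sampleCov x) (sampleMean x - θ) := by
    refine le_ciInf fun θ => ?_
    rw [normSq_sampleCov hn hx, mul_left_comm]
    exact mul_le_mul_of_nonneg_left (h θ θ.2) hn'.le
  have hq : n * normSq (sampleCov x) (sampleMean x) =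
      (n - 1) * ((scatterAbout 0 x).det / (scatter x).det - 1) := by
    rw [normSq_sampleCov hn hx, det_scatterAbout (by lia) 0 hx, sub_zero]
    field_simp
    ring
  have hE' : 0 ≤ (n - 1) * E := by positivity
  rw [statL, sub_lt_iff_lt_add, div_lt_iff₀ (by linarith), hq]
  refine hlt.trans_le ?_
  rw [add_comm l 1]
  gcongr

theorem le_statL {n p : ℕ} (hn : 1 < n) {C : Set (Fin p → ℝ)} {x : Sample n p}
    (hx : 0 < (scatter x).det) (hxC : sampleMean x ∈ C) {l : ℝ}
    (h : l ≤ (n - 1) * ((scatterAbout 0 x).det / (scatter x).det - 1)) : l ≤ statL C x := by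
  have hn' : (0 : ℝ) < n - 1 := by
    have : (1 : ℝ) < n := by exact_mod_cast hn
    linarith
  have hpos (u : Fin p → ℝ) : 0 ≤ n * normSq (sampleCov x) u := by
    rw [normSq_sampleCov hn hx]
    have := normSq_nonneg (posSemidef_scatterAbout (sampleMean x) x) u
    have : 0 ≤ normSq (scatter x) u := this
    positivity
  have hinf : ⨅ θ : C, n * normSq (sampleCov x) (sampleMean x - θ) = 0 := by
    refine le_antisymm ?_ (Real.iInf_nonneg fun θ => hpos _)
    refine (ciInf_le ⟨0, by rintro _ ⟨θ, rfl⟩; exact hpos _⟩ ⟨sampleMean x, hxC⟩).trans ?_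
    simp [normSq]
  have hq : n * normSq (sampleCov x) (sampleMean x) =
      (n - 1) * ((scatterAbout 0 x).det / (scatter x).det - 1) := by
    rw [normSq_sampleCov hn hx, det_scatterAbout (by lia) 0 hx, sub_zero]
    field_simp
    ring
  rw [statL, hinf, hq, add_zero, div_one, add_sub_cancel_left]
  exact h

/-- The test based on `L` is a ratio test with `κ = 1 + l / (n - 1)`, since
`n x̄' S⁻¹ x̄ = (n - 1) (det T₀ / det W - 1)`. -/
theorem isRatioTest_testL {n p : ℕ} (hn : 1 < n) (I : Set (Fin p)) {l : ℝ} (hl : 0 < l) :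
    ∃ κ, 1 < κ ∧ IsRatioTest (signCone I) κ (testL (n := n) (signCone I) l) := by
  have hn' : (0 : ℝ) < n - 1 := by
    have : (1 : ℝ) < n := by exact_mod_cast hn
    linarith
  have hn0 : n ≠ 0 := by lia
  have hC : (signCone I).Nonempty := ⟨0, fun _ _ => le_rfl⟩
  have hκ : (n - 1) * (1 + l / (n - 1) - 1) = l := by field_simp; ring
  refine ⟨1 + l / (n - 1), lt_add_of_pos_right _ (by positivity), ⟨fun x hx hxC h => ?_,
    fun x hx h => ?_, fun x hx hxC h => ?_⟩⟩
  · refine if_pos (le_statL hn hx hxC ?_)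
    rw [← le_div_iff₀ hx] at h
    calc l = (n - 1) * (1 + l / (n - 1) - 1) := hκ.symm
      _ ≤ _ := by gcongr
  · refine if_neg (not_le.2 (statL_lt hn hC hx le_rfl hl (fun θ _ => ?_) ?_))
    · have : 0 ≤ normSq (scatter x) (sampleMean x - θ) :=
        normSq_nonneg (posSemidef_scatterAbout (sampleMean x) x) _
      positivity
    · rw [← div_lt_iff₀ hx] at h
      rw [mul_zero, add_zero, mul_one, ← hκ]
      gcongr
  · obtain ⟨E, hEc, hE0, hE⟩ := exists_lower_bound_of_notMem hn0 hx hxC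
    have hlt : 1 + (n - 1) * ((scatterAbout 0 x).det / (scatter x).det - 1) <
        (1 + l) * (1 + (n - 1) * E x) := by
      rw [h, mul_div_cancel_right₀ _ hx.ne', hκ]
      exact lt_mul_of_one_lt_right (by positivity) (lt_add_of_pos_right _ (by positivity))
    have hc : ContinuousAt (fun y : Sample n p => (1 + l) * (1 + (n - 1) * E y)) x := by
      fun_prop
    have hc0 : ContinuousAt (fun y : Sample n p =>
        1 + ((n : ℝ) - 1) * ((scatterAbout 0 y).det / (scatter y).det - 1)) x :=
      continuousAt_const.add (continuousAt_const.mul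
        (((continuous_scatterAbout 0).matrix_det.continuousAt.div
          continuous_scatter.matrix_det.continuousAt hx.ne').sub continuousAt_const))
    filter_upwards [hE, eventually_det_scatter_pos hx, hc0.eventually_lt hc hlt] with y hEy hy hlt'
    exact if_neg (not_le.2 (statL_lt hn hC hy hEy.1 hl hEy.2 hlt'))

/-! ### Normal densities have total mass one -/

theorem lintegral_exp_neg_half_sum_sq (p : ℕ) :
    ∫⁻ u : Fin p → ℝ, ENNReal.ofReal (Real.exp (-(1 / 2) * ∑ i, u i ^ 2)) =
      ENNReal.ofReal (Real.sqrt ((2 * Real.pi) ^ p)) := by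
  have hprod (u : Fin p → ℝ) :
      Real.exp (-(1 / 2) * ∑ i, u i ^ 2) = ∏ i, Real.exp (-(1 / 2) * u i ^ 2) := by
    rw [Finset.mul_sum, Real.exp_sum]
  have hint : Integrable fun t : ℝ => Real.exp (-(1 / 2) * t ^ 2) :=
    integrable_exp_neg_mul_sq (by norm_num)
  have hI : Integrable (fun u : Fin p → ℝ => ∏ i, Real.exp (-(1 / 2) * u i ^ 2)) volume :=
    Integrable.fintype_prod (f := fun _ t => Real.exp (-(1 / 2) * t ^ 2)) fun _ => hint
  simp only [hprod]
  rw [← ofReal_integral_eq_lintegral_ofReal hI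
    (Eventually.of_forall fun _ => by positivity),
    integral_fintype_prod_volume_eq_pow fun t : ℝ => Real.exp (-(1 / 2) * t ^ 2),
    integral_gaussian, Fintype.card_fin, Real.sqrt_eq_rpow, Real.sqrt_eq_rpow,
    ← Real.rpow_natCast, ← Real.rpow_natCast, ← Real.rpow_mul (by positivity),
    ← Real.rpow_mul (by positivity), mul_comm]
  congr 3
  ring

open scoped MatrixOrder in
/-- With `A⁻¹ = R' R`, the linear change of variables `u = R (v - θ)` reduces the claim to the
standard normal density. -/
theorem lintegral_normalDensity {p : ℕ} (θ : Fin p → ℝ) {A : Matrix (Fin p) (Fin p) ℝ}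
    (hA : A.PosDef) : ∫⁻ v, ENNReal.ofReal (normalDensity θ A v) = 1 := by
  obtain ⟨R, hR⟩ := CStarAlgebra.nonneg_iff_eq_star_mul_self.1 hA.inv.posSemidef.nonneg
  rw [star_eq_conjTranspose, conjTranspose_eq_transpose_of_trivial] at hR
  have hd := hA.det_pos
  have hdet : A.det⁻¹ = R.det ^ 2 := by
    rw [← Ring.inverse_eq_inv', ← det_nonsing_inv, hR, det_mul, det_transpose, sq]
  have hR0 : R.det ≠ 0 := by
    intro h
    rw [h] at hdet
    have := inv_pos.2 hd
    simp_all
  have hq (v : Fin p → ℝ) : normSq A v = ∑ i, (R *ᵥ v) i ^ 2 := by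
    rw [normSq, hR, ← mulVec_mulVec, dotProduct_mulVec, vecMul_transpose]
    simp [dotProduct, sq]
  set c := (Real.sqrt ((2 * Real.pi) ^ p * A.det))⁻¹ with hc
  have hc0 : 0 ≤ c := by positivity
  set g : (Fin p → ℝ) → ℝ≥0∞ := fun u => ENNReal.ofReal (Real.exp (-(1 / 2) * ∑ i, u i ^ 2))
    with hg
  have hgm : Measurable g := by fun_prop
  calc ∫⁻ v, ENNReal.ofReal (normalDensity θ A v)
      = ∫⁻ v, ENNReal.ofReal c * g (R *ᵥ (v - θ)) := by
        refine lintegral_congr fun v => ?_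
        rw [normalDensity, ENNReal.ofReal_mul hc0, hq]
    _ = ENNReal.ofReal c * ∫⁻ v, g (R *ᵥ v) := by
        rw [lintegral_const_mul' _ _ ENNReal.ofReal_ne_top,
          lintegral_sub_right_eq_self (fun v => g (R *ᵥ v)) θ]
    _ = ENNReal.ofReal c * ∫⁻ u, g u ∂(Measure.map (toLin' R) volume) := by
        rw [lintegral_map hgm (by
          exact (LinearMap.continuous_of_finiteDimensional (toLin' R)).measurable)]
        simp
    _ = ENNReal.ofReal (c * (|R.det⁻¹| * Real.sqrt ((2 * Real.pi) ^ p))) := by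
        rw [Real.map_matrix_volume_pi_eq_smul_volume_pi hR0, lintegral_smul_measure,
          lintegral_exp_neg_half_sum_sq, smul_eq_mul, ← ENNReal.ofReal_mul (by positivity),
          ← ENNReal.ofReal_mul hc0]
    _ = 1 := by
        have hpi := Real.pi_pos
        have : |R.det⁻¹| = Real.sqrt A.det := by
          rw [← Real.sqrt_sq_eq_abs, inv_pow, ← hdet, inv_inv]
        rw [this, hc, Real.sqrt_mul (by positivity), mul_comm (Real.sqrt A.det),
          inv_mul_cancel₀ (by positivity), ENNReal.ofReal_one]

theorem lintegral_likelihood {n p : ℕ} (θ : Fin p → ℝ) {A : Matrix (Fin p) (Fin p) ℝ}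
    (hA : A.PosDef) : ∫⁻ x : Sample n p, ENNReal.ofReal (likelihood θ A x) = 1 := by
  have h1 := lintegral_normalDensity θ hA
  have hnn (v : Fin p → ℝ) : 0 ≤ normalDensity θ A v := by unfold normalDensity; positivity
  have hm : Continuous (normalDensity θ A) := by
    have := continuous_normSq A
    unfold normalDensity
    fun_prop
  have hint : Integrable (normalDensity θ A) :=
    (lintegral_ofReal_ne_top_iff_integrable hm.aestronglyMeasurable
      (Eventually.of_forall hnn)).1 (by rw [h1]; exact ENNReal.one_ne_top)
  have h2 : ∫ v, normalDensity θ A v = 1 := by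
    rw [integral_eq_lintegral_of_nonneg_ae (Eventually.of_forall hnn) hm.aestronglyMeasurable, h1,
      ENNReal.toReal_one]
  have hI : Integrable (fun x : Sample n p => ∏ j, normalDensity θ A (x j)) volume :=
    Integrable.fintype_prod (f := fun _ => normalDensity θ A) fun _ => hint
  unfold likelihood
  rw [← ofReal_integral_eq_lintegral_ofReal hI
    (Eventually.of_forall fun _ => Finset.prod_nonneg fun _ _ => hnn _),
    integral_fintype_prod_volume_eq_pow, h2, one_pow, ENNReal.ofReal_one]

/-! ### Mixtures of likelihoods and the Bayes risk -/

/-- The mixture of the normal likelihoods with respect to a measure on the parameters. -/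
def mix {n p : ℕ} (μ : Measure (Param p)) (x : Sample n p) : ℝ≥0∞ :=
  ∫⁻ ω, ENNReal.ofReal (likelihood ω.1 (disp ω) x) ∂μ

theorem measurable_mix {n p : ℕ} (μ : Measure (Param p)) [SFinite μ] :
    Measurable (mix μ : Sample n p → ℝ≥0∞) :=
  Measurable.lintegral_prod_left (μ := μ)
    (f := fun (ω : Param p) (x : Sample n p) => ENNReal.ofReal (likelihood ω.1 (disp ω) x))
    measurable_likelihood.ennreal_ofReal

theorem measurable_likelihood_param {n p : ℕ} (x : Sample n p) :
    Measurable fun ω : Param p => likelihood ω.1 (disp ω) x :=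
  Measurable.of_uncurry_right (f := fun (ω : Param p) (x : Sample n p) => likelihood ω.1 (disp ω) x)
    measurable_likelihood

theorem lintegral_lintegral_sampleLaw {n p : ℕ} (μ : Measure (Param p)) [SFinite μ]
    {g : Sample n p → ℝ≥0∞} (hg : Measurable g) :
    ∫⁻ ω, ∫⁻ x, g x ∂(sampleLaw n ω.1 (disp ω)) ∂μ = ∫⁻ x, g x * mix μ x := by
  have hm : Measurable fun q : Param p × Sample n p =>
      ENNReal.ofReal (likelihood q.1.1 (disp q.1) q.2) * g q.2 :=
    measurable_likelihood.ennreal_ofReal.mul (hg.comp measurable_snd)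
  calc _ = ∫⁻ ω, (∫⁻ x, ENNReal.ofReal (likelihood ω.1 (disp ω) x) * g x) ∂μ := by
        refine lintegral_congr fun ω => ?_
        exact lintegral_withDensity_eq_lintegral_mul _
          (continuous_likelihood _ _).measurable.ennreal_ofReal hg
    _ = ∫⁻ x, (∫⁻ ω, ENNReal.ofReal (likelihood ω.1 (disp ω) x) * g x ∂μ) :=
        lintegral_lintegral_swap hm.aemeasurable
    _ = _ := by
        refine lintegral_congr fun x => ?_
        rw [lintegral_mul_const _ (measurable_likelihood_param x).ennreal_ofReal, mul_comm, mix]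

theorem lintegral_mix {n p : ℕ} (μ : Measure (Param p)) [SFinite μ]
    (hμ : ∀ᵐ ω ∂μ, (disp ω).PosDef) : ∫⁻ x : Sample n p, mix μ x = μ Set.univ := by
  have := lintegral_lintegral_sampleLaw (n := n) μ (g := 1) measurable_one
  simp only [Pi.one_apply, one_mul, lintegral_one] at this
  rw [← this, ← lintegral_one]
  refine lintegral_congr_ae (hμ.mono fun ω hω => ?_)
  simp [sampleLaw, lintegral_likelihood ω.1 hω]

theorem continuousAt_mix {n p : ℕ} (hn : n ≠ 0) (μ : Measure (Param p)) [IsFiniteMeasure μ]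
    (hμ : ∀ᵐ ω ∂μ, (disp ω).PosDef) {x : Sample n p} (hx : 0 < (scatter x).det) :
    ContinuousAt (mix μ) x := by
  -- the maximized likelihood is a constant dominating function near `x`
  set d := (scatter x).det / 2 with hd
  have hd0 : 0 < d := by positivity
  refine tendsto_lintegral_filter_of_dominated_convergence
    (fun _ => ENNReal.ofReal (peak n p * (Real.sqrt d)⁻¹ ^ n))
    (Eventually.of_forall fun y => (measurable_likelihood_param y).ennreal_ofReal) ?_ ?_ ?_
  · filter_upwards [continuous_scatter.matrix_det.continuousAt.eventually
      (lt_mem_nhds (half_lt_self hx))] with y hy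
    have hy0 : 0 < (scatter y).det := hd0.trans hy
    filter_upwards [hμ] with ω hω
    have hle := det_scatter_le_det_scatterAbout hn ω.1 hy0
    refine ENNReal.ofReal_le_ofReal ((likelihood_le hn _ hω (hy0.trans_le hle)).trans ?_)
    have := peak_pos p hn
    have := Real.sqrt_pos.2 hd0
    have : d ≤ (scatterAbout ω.1 y).det := (hd ▸ hy.le).trans hle
    gcongr
  · rw [lintegral_const]
    exact ENNReal.mul_ne_top ENNReal.ofReal_ne_top (measure_ne_top _ _)
  · exact Eventually.of_forall fun ω =>
      (ENNReal.continuous_ofReal.comp (continuous_likelihood _ _)).continuousAt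

theorem mix_lt_top {n p : ℕ} (hn : n ≠ 0) (μ : Measure (Param p)) [IsFiniteMeasure μ]
    (hμ : ∀ᵐ ω ∂μ, (disp ω).PosDef) {x : Sample n p} (hx : 0 < (scatter x).det) :
    mix μ x < ∞ := by
  have hpeak := peak_pos p hn
  have hsq := Real.sqrt_pos.2 hx
  refine lt_of_le_of_lt (lintegral_mono_ae (g := fun _ =>
    ENNReal.ofReal (peak n p * (Real.sqrt (scatter x).det)⁻¹ ^ n)) ?_) ?_
  · filter_upwards [hμ] with ω hω
    have hle := det_scatter_le_det_scatterAbout hn ω.1 hx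
    refine ENNReal.ofReal_le_ofReal ((likelihood_le hn _ hω (hx.trans_le hle)).trans ?_)
    gcongr
  · rw [lintegral_const]
    exact ENNReal.mul_lt_top ENNReal.ofReal_lt_top (measure_lt_top _ _)

/-- The part of a prior that sits on the null hypothesis. -/
def nullPart {p : ℕ} (G : Measure (Param p)) : Measure (Param p) := G.restrict {ω | ω.1 = 0}

/-- The part of a prior that sits on the alternative. -/
def altPart {p : ℕ} (G : Measure (Param p)) : Measure (Param p) := G.restrict {ω | ω.1 = 0}ᶜ

instance {p : ℕ} (G : Measure (Param p)) [IsFiniteMeasure G] : IsFiniteMeasure (nullPart G) := by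
  unfold nullPart; infer_instance

instance {p : ℕ} (G : Measure (Param p)) [IsFiniteMeasure G] : IsFiniteMeasure (altPart G) := by
  unfold altPart; infer_instance

theorem measurableSet_null {p : ℕ} : MeasurableSet {ω : Param p | ω.1 = 0} :=
  measurable_fst (measurableSet_singleton 0)

/-- The Bayes risk as an integral over the sample space, by Tonelli's theorem. -/
theorem averageRisk_eq {n p : ℕ} (G : Measure (Param p)) [IsFiniteMeasure G] (a b : ℝ≥0)
    {φ : Sample n p → ℝ≥0∞} (hφ : Measurable φ) : averageRisk G a b φ =
      ∫⁻ x, (φ x * (a * mix (nullPart G) x) + (1 - φ x) * (b * mix (altPart G) x)) := by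
  have h0 := measurable_mix (n := n) (nullPart G)
  have h1 := measurable_mix (n := n) (altPart G)
  have e0 : ∫⁻ ω in {ω : Param p | ω.1 = 0}, (if ω.1 = 0 then
      (a : ℝ≥0∞) * ∫⁻ x, φ x ∂(sampleLaw n ω.1 (disp ω))
      else (b : ℝ≥0∞) * ∫⁻ x, (1 - φ x) ∂(sampleLaw n ω.1 (disp ω))) ∂G =
      a * ∫⁻ ω, ∫⁻ x, φ x ∂(sampleLaw n ω.1 (disp ω)) ∂(nullPart G) := by
    rw [← lintegral_const_mul' _ _ ENNReal.coe_ne_top]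
    exact setLIntegral_congr_fun measurableSet_null fun ω hω => if_pos hω
  have e1 : ∫⁻ ω in {ω : Param p | ω.1 = 0}ᶜ, (if ω.1 = 0 then
      (a : ℝ≥0∞) * ∫⁻ x, φ x ∂(sampleLaw n ω.1 (disp ω))
      else (b : ℝ≥0∞) * ∫⁻ x, (1 - φ x) ∂(sampleLaw n ω.1 (disp ω))) ∂G =
      b * ∫⁻ ω, ∫⁻ x, (1 - φ x) ∂(sampleLaw n ω.1 (disp ω)) ∂(altPart G) := by
    rw [← lintegral_const_mul' _ _ ENNReal.coe_ne_top]
    exact setLIntegral_congr_fun measurableSet_null.compl fun ω hω => if_neg hω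
  rw [averageRisk, ← lintegral_add_compl _ measurableSet_null]
  convert congrArg₂ (· + ·) e0 e1 using 1
  rw [lintegral_lintegral_sampleLaw _ hφ, lintegral_lintegral_sampleLaw _ (hφ.const_sub 1),
    ← lintegral_const_mul' _ _ ENNReal.coe_ne_top, ← lintegral_const_mul' _ _ ENNReal.coe_ne_top,
    ← lintegral_add_left (by fun_prop)]
  refine lintegral_congr fun x => ?_
  ring

/-- A Bayes test rejects only where the alternative has the larger weighted mixture density, and
accepts only where the null hypothesis has. -/
theorem ae_of_averageRisk_le {n p : ℕ} (G : Measure (Param p)) [IsFiniteMeasure G]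
    (hG : ∀ᵐ ω ∂G, (disp ω).PosDef) (a b : ℝ≥0) {φ : Sample n p → ℝ≥0∞} (hφ : IsTest φ)
    (h : ∀ ψ : Sample n p → ℝ≥0∞, IsTest ψ → averageRisk G a b φ ≤ averageRisk G a b ψ) :
    ∀ᵐ x, (φ x = 1 → a * mix (nullPart G) x ≤ b * mix (altPart G) x) ∧
      (φ x = 0 → b * mix (altPart G) x ≤ a * mix (nullPart G) x) := by
  set f₀ : Sample n p → ℝ≥0∞ := fun x => a * mix (nullPart G) x
  set f₁ : Sample n p → ℝ≥0∞ := fun x => b * mix (altPart G) x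
  have hf₀ : Measurable f₀ := (measurable_mix _).const_mul _
  have hf₁ : Measurable f₁ := (measurable_mix _).const_mul _
  -- the competitor that minimizes the integrand of the Bayes risk pointwise
  set ψ : Sample n p → ℝ≥0∞ := {x | f₀ x ≤ f₁ x}.indicator 1 with hψ
  have hψm : Measurable ψ := measurable_one.indicator (measurableSet_le hf₀ hf₁)
  have hψt : IsTest ψ := ⟨hψm, fun x => Set.indicator_le_self' (fun _ _ => zero_le) x⟩
  have hψ_eq (x : Sample n p) : ψ x * f₀ x + (1 - ψ x) * f₁ x = min (f₀ x) (f₁ x) := by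
    by_cases hx : f₀ x ≤ f₁ x
    · simp [hψ, hx]
    · simp [hψ, hx, (not_le.1 hx).le]
  have hle := h ψ hψt
  rw [averageRisk_eq G a b hφ.measurable, averageRisk_eq G a b hψm] at hle
  have hfin : ∫⁻ x, min (f₀ x) (f₁ x) ≠ ∞ := by
    refine ((lintegral_mono fun x => min_le_left _ _).trans_lt ?_).ne
    rw [lintegral_const_mul' _ _ ENNReal.coe_ne_top,
      lintegral_mix (nullPart G) (ae_restrict_of_ae hG)]
    exact ENNReal.mul_lt_top ENNReal.coe_lt_top (measure_lt_top _ _)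
  have hae := ae_eq_of_ae_le_of_lintegral_le (μ := volume)
    (f := fun x => min (f₀ x) (f₁ x)) (g := fun x => φ x * f₀ x + (1 - φ x) * f₁ x)
    (Eventually.of_forall fun x => ?_) hfin
    ((hφ.measurable.mul hf₀).add ((hφ.measurable.const_sub 1).mul hf₁)).aemeasurable
    (hle.trans_eq (lintegral_congr hψ_eq))
  · filter_upwards [hae] with x hx
    refine ⟨fun h1 => ?_, fun h0 => ?_⟩
    · simpa [h1] using hx
    · simpa [h0] using hx
  · calc min (f₀ x) (f₁ x) = (φ x + (1 - φ x)) * min (f₀ x) (f₁ x) := by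
          rw [add_tsub_cancel_of_le (hφ.le_one x), one_mul]
      _ ≤ _ := by
          rw [add_mul]
          exact add_le_add (mul_le_mul' le_rfl (min_le_left _ _))
            (mul_le_mul' le_rfl (min_le_right _ _))

/-- An almost everywhere inequality on `P` holds at a point of continuity that is a limit of
interior points of `P`. -/
theorem le_of_frequently_eventually {X : Type*} [TopologicalSpace X] [MeasurableSpace X]
    {μ : Measure X} [μ.IsOpenPosMeasure] {f g : X → ℝ≥0∞} {P : X → Prop} {x : X}
    (hae : ∀ᵐ z ∂μ, P z → f z ≤ g z) (hf : ContinuousAt f x) (hg : ContinuousAt g x)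
    (h : ∃ᶠ y in 𝓝 x, ∀ᶠ z in 𝓝 y, P z) : f x ≤ g x := by
  by_contra! hlt
  obtain ⟨y, hy, hy'⟩ := (h.and_eventually (eventually_eventually_nhds.2
    (hg.eventually_lt hf hlt))).exists
  obtain ⟨U, hU, hUo, hyU⟩ := mem_nhds_iff.1 (hy.and hy')
  obtain ⟨z, hzU, hz⟩ := (Measure.dense_of_ae hae).inter_open_nonempty U hUo ⟨y, hyU⟩
  exact (hU hzU).2.not_ge (hz (hU hzU).1)

/-! ### Samples with second moment matrix the identity -/

/-- The rows `z 0, …, z (n - 1)` of an `n × p` matrix with orthonormal columns, each of them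
orthogonal to the constant vector. -/
structure IsCenteredFrame {n p : ℕ} (z : Sample n p) : Prop where
  sum_eq : ∀ i, ∑ j, z j i = 0
  sum_mul : ∀ i k, ∑ j, z j i * z j k = if i = k then 1 else 0

/-- Complete the normalized constant vector to an orthonormal basis of `ℝ^n`; this is where `p < n`
is needed. -/
theorem exists_isCenteredFrame {n p : ℕ} (h : p < n) : ∃ z : Sample n p, IsCenteredFrame z := by
  have hn0 : (n : ℝ) ≠ 0 := Nat.cast_ne_zero.2 (by lia)
  let i₀ : Fin n := ⟨0, by lia⟩
  let v : Fin n → EuclideanSpace ℝ (Fin n) := fun _ => WithLp.toLp 2 fun _ => (Real.sqrt n)⁻¹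
  have hv : Orthonormal ℝ (({i₀} : Set (Fin n)).domRestrict v) := by
    refine ⟨fun _ => ?_, fun i j hij => absurd (Subsingleton.elim i j) hij⟩
    simp [v, EuclideanSpace.norm_eq, Set.domRestrict_apply, hn0]
  obtain ⟨b, hb⟩ := hv.exists_orthonormalBasis_extension_of_card_eq (by simp)
  have hb0 := hb i₀ rfl
  let e : Fin p → Fin n := fun i => ⟨i + 1, by lia⟩
  have he : Function.Injective e := fun i k hik => by
    simpa [e, Fin.ext_iff] using hik
  have hinner (i k : Fin n) : ∑ j, b i j * b k j = if i = k then 1 else 0 := by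
    have := orthonormal_iff_ite.1 b.orthonormal k i
    rw [PiLp.inner_apply] at this
    simpa [eq_comm] using this
  refine ⟨fun j i => b (e i) j, fun i => ?_, fun i k => ?_⟩
  · have hne : e i ≠ i₀ := by simp [e, i₀, Fin.ext_iff]
    have := hinner (e i) i₀
    rw [hb0, if_neg hne, ← Finset.sum_mul] at this
    exact (mul_eq_zero.1 this).resolve_right (by simp [hn0])
  · rw [hinner]
    simp [he.eq_iff]

/-- A sample with mean `v` and second moment matrix `∑ x_j x_j' = 1`, for `n |v|² < 1`. It is
`v + (1 - β v v') z_j`, where `β` solves `(1 - β v v')² = 1 - n v v'`. -/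
def frameSample {n p : ℕ} (z : Sample n p) (v : Fin p → ℝ) : Sample n p := fun j =>
  v + z j - (n / (1 + Real.sqrt (1 - n * (v ⬝ᵥ v))) * (z j ⬝ᵥ v)) • v

theorem continuous_frameSample {n p : ℕ} (z : Sample n p) : Continuous (frameSample z) := by
  unfold frameSample
  refine continuous_pi fun j => ?_
  have h (v : Fin p → ℝ) : 1 + Real.sqrt (1 - n * (v ⬝ᵥ v)) ≠ 0 := by positivity
  have hd : Continuous fun v : Fin p → ℝ => v ⬝ᵥ v :=
    Continuous.dotProduct continuous_id continuous_id
  have hz : Continuous fun v : Fin p → ℝ => z j ⬝ᵥ v :=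
    Continuous.dotProduct continuous_const continuous_id
  fun_prop (disch := exact h)

theorem sampleMean_frameSample {n p : ℕ} (hn : n ≠ 0) {z : Sample n p} (hz : IsCenteredFrame z)
    (v : Fin p → ℝ) : sampleMean (frameSample z v) = v := by
  have hn' : (n : ℝ) ≠ 0 := Nat.cast_ne_zero.2 hn
  have hdot : ∑ j, z j ⬝ᵥ v = 0 := by
    simp only [dotProduct]
    rw [Finset.sum_comm]
    simp [← Finset.sum_mul, hz.sum_eq]
  ext i
  rw [sampleMean_apply]
  simp only [frameSample, Pi.sub_apply, Pi.add_apply, Pi.smul_apply, smul_eq_mul,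
    Finset.sum_sub_distrib, Finset.sum_add_distrib, hz.sum_eq, ← Finset.sum_mul, ← Finset.mul_sum,
    hdot, Finset.sum_const, Finset.card_univ, Fintype.card_fin, nsmul_eq_mul]
  field_simp
  ring

theorem scatterAbout_zero_frameSample {n p : ℕ} {z : Sample n p} (hz : IsCenteredFrame z)
    {v : Fin p → ℝ} (hv : n * (v ⬝ᵥ v) ≤ 1) : scatterAbout 0 (frameSample z v) = 1 := by
  set s := Real.sqrt (1 - n * (v ⬝ᵥ v)) with hs
  have hs2 : s ^ 2 = 1 - n * (v ⬝ᵥ v) := Real.sq_sqrt (by linarith)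
  have hs1 : 1 + s ≠ 0 := by positivity
  set β := n / (1 + s) with hβ
  -- the equation `(1 - β v v')² = 1 - n v v'`
  have hquad : n - 2 * β + β ^ 2 * (v ⬝ᵥ v) = 0 := by
    have hβs : β * (1 + s) = n := by rw [hβ]; field_simp
    have : n * (n - 2 * β + β ^ 2 * (v ⬝ᵥ v)) = 0 := by
      linear_combination β ^ 2 * hs2 - (β * (1 + s) + n - 2 * β) * hβs
    rcases mul_eq_zero.1 this with h | h
    · have : β = 0 := by rw [hβ, h, zero_div]
      rw [h, this]; ring
    · exact h
  have hdot : ∑ j, z j ⬝ᵥ v = 0 := by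
    simp only [dotProduct]
    rw [Finset.sum_comm]
    simp [← Finset.sum_mul, hz.sum_eq]
  have hzz (i : Fin p) : ∑ j, z j i * (z j ⬝ᵥ v) = v i := by
    simp only [dotProduct, Finset.mul_sum]
    rw [Finset.sum_comm]
    simp [← mul_assoc, ← Finset.sum_mul, hz.sum_mul]
  have hvv : ∑ j, (z j ⬝ᵥ v) * (z j ⬝ᵥ v) = v ⬝ᵥ v := by
    calc ∑ j, (z j ⬝ᵥ v) * (z j ⬝ᵥ v) = ∑ j, ∑ i, v i * (z j i * (z j ⬝ᵥ v)) := by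
          refine Finset.sum_congr rfl fun j _ => ?_
          conv_lhs => rw [dotProduct, Finset.sum_mul]
          exact Finset.sum_congr rfl fun i _ => by rw [dotProduct]; ring
      _ = ∑ i, v i * v i := by
          rw [Finset.sum_comm]
          simp only [← Finset.mul_sum, hzz]
      _ = v ⬝ᵥ v := rfl
  ext i k
  rw [scatterAbout_apply, one_apply]
  have hexp (j : Fin n) : (frameSample z v j i - (0 : Fin p → ℝ) i) *
      (frameSample z v j k - (0 : Fin p → ℝ) k) =
      v i * v k + v i * z j k + v k * z j i + z j i * z j k -
      2 * (β * v i * v k) * (z j ⬝ᵥ v) - β * v k * (z j i * (z j ⬝ᵥ v)) -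
      β * v i * (z j k * (z j ⬝ᵥ v)) + β ^ 2 * v i * v k * ((z j ⬝ᵥ v) * (z j ⬝ᵥ v)) := by
    simp only [frameSample, Pi.sub_apply, Pi.add_apply, Pi.smul_apply, smul_eq_mul, Pi.zero_apply,
      ← hs, ← hβ]
    ring
  simp only [hexp, Finset.sum_add_distrib, Finset.sum_sub_distrib, ← Finset.mul_sum, hz.sum_eq,
    hz.sum_mul, hzz, hvv, hdot, Finset.sum_const, Finset.card_univ, Fintype.card_fin, nsmul_eq_mul]
  linear_combination (v i * v k) * hquad

theorem det_scatter_frameSample {n p : ℕ} (hn : n ≠ 0) {z : Sample n p} (hz : IsCenteredFrame z)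
    {v : Fin p → ℝ} (hv : n * (v ⬝ᵥ v) ≤ 1) :
    (scatter (frameSample z v)).det = 1 - n * (v ⬝ᵥ v) := by
  have h := scatterAbout_eq_scatter_add hn 0 (frameSample z v)
  rw [scatterAbout_zero_frameSample hz hv, sampleMean_frameSample hn hz, sub_zero] at h
  have h' : scatter (frameSample z v) = 1 + (-(n : ℝ)) • vecMulVec v v := by
    rw [h, neg_smul, add_neg_cancel_right]
  rw [h', det_add_smul_vecMulVec (by simp)]
  simp [normSq, sub_eq_add_neg]

/-- The factor of the likelihood that does not depend on the sample mean, on samples whose second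
moment matrix is the identity. -/
def weight (n : ℕ) {p : ℕ} (θ : Fin p → ℝ) (A : Matrix (Fin p) (Fin p) ℝ) : ℝ :=
  (Real.sqrt ((2 * Real.pi) ^ p * A.det))⁻¹ ^ n *
    Real.exp (-(1 / 2) * ((A⁻¹).trace + n * normSq A θ))

theorem weight_pos (n : ℕ) {p : ℕ} (θ : Fin p → ℝ) {A : Matrix (Fin p) (Fin p) ℝ}
    (hA : A.PosDef) : 0 < weight n θ A := by
  have := hA.det_pos
  have := Real.pi_pos
  unfold weight
  positivity

theorem likelihood_of_scatterAbout_zero {n p : ℕ} (hn : n ≠ 0) (θ : Fin p → ℝ)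
    {A : Matrix (Fin p) (Fin p) ℝ} (hA : A.PosDef) {x : Sample n p} (hx : scatterAbout 0 x = 1) :
    likelihood θ A x = weight n θ A * Real.exp (n * ((A⁻¹ *ᵥ θ) ⬝ᵥ sampleMean x)) := by
  have hn' : (n : ℝ) ≠ 0 := Nat.cast_ne_zero.2 hn
  have hsym : A⁻¹ᵀ = A⁻¹ := by simpa using hA.inv.isHermitian.eq
  have hsum : ∑ j, x j = (n : ℝ) • sampleMean x := by
    rw [sampleMean, smul_smul, mul_inv_cancel₀ hn', one_smul]
  have hexp (j : Fin n) : normSq A (x j - θ) =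
      normSq A (x j - 0) - 2 * ((A⁻¹ *ᵥ θ) ⬝ᵥ x j) + normSq A θ := by
    have h1 : θ ⬝ᵥ (A⁻¹ *ᵥ x j) = (A⁻¹ *ᵥ θ) ⬝ᵥ x j := by
      rw [dotProduct_mulVec, ← mulVec_transpose, hsym]
    simp only [normSq, mulVec_sub, sub_dotProduct, dotProduct_sub, sub_zero, h1,
      dotProduct_comm (x j) (A⁻¹ *ᵥ θ)]
    ring
  have htr : (A⁻¹ * scatterAbout θ x).trace =
      (A⁻¹).trace - 2 * (n * ((A⁻¹ *ᵥ θ) ⬝ᵥ sampleMean x)) + n * normSq A θ := by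
    rw [← sum_normSq_eq_trace]
    simp only [hexp, Finset.sum_add_distrib, Finset.sum_sub_distrib, sum_normSq_eq_trace, hx,
      Matrix.mul_one, ← Finset.mul_sum, ← dotProduct_sum, hsum, dotProduct_smul, smul_eq_mul,
      Finset.sum_const, Finset.card_univ, Fintype.card_fin, nsmul_eq_mul]
  rw [likelihood_eq, htr, weight, mul_assoc, ← Real.exp_add]
  congr 2
  ring

theorem likelihood_frameSample {n p : ℕ} (hn : n ≠ 0) (θ : Fin p → ℝ)
    {A : Matrix (Fin p) (Fin p) ℝ} (hA : A.PosDef) {z : Sample n p} (hz : IsCenteredFrame z)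
    {v : Fin p → ℝ} (hv : n * (v ⬝ᵥ v) ≤ 1) : likelihood θ A (frameSample z v) =
      weight n θ A * Real.exp (n * ((A⁻¹ *ᵥ θ) ⬝ᵥ v)) := by
  rw [likelihood_of_scatterAbout_zero hn θ hA (scatterAbout_zero_frameSample hz hv),
    sampleMean_frameSample hn hz]

/-- Under the null hypothesis the likelihood depends on the sample only through its second moment
matrix. -/
theorem mix_nullPart_congr {n p : ℕ} (G : Measure (Param p)) {x y : Sample n p}
    (h : scatterAbout 0 x = scatterAbout 0 y) : mix (nullPart G) x = mix (nullPart G) y := by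
  refine setLIntegral_congr_fun measurableSet_null fun ω hω => ?_
  have hω' : ω.1 = 0 := hω
  simp only [hω', likelihood_eq, h]

/-! ### Strict convexity in the mean -/

/-- A local maximum of the mixture in the direction of the mean is impossible unless the mixing
measure sits on the null hypothesis: in each coordinate direction the mixture is an integral of
exponentials, which is strictly convex. -/
theorem ae_eq_zero_of_eventually_le {n p : ℕ} (hn : n ≠ 0) (μ : Measure (Param p))
    [IsFiniteMeasure μ] (hμ : ∀ᵐ ω ∂μ, (disp ω).PosDef) {z : Sample n p} (hz : IsCenteredFrame z)
    {v₀ : Fin p → ℝ} (hv₀ : n * (v₀ ⬝ᵥ v₀) < 1)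
    (hmax : ∀ᶠ v in 𝓝 v₀, mix μ (frameSample z v) ≤ mix μ (frameSample z v₀)) :
    ∀ᵐ ω ∂μ, ω.1 = 0 := by
  have hn' : (n : ℝ) ≠ 0 := Nat.cast_ne_zero.2 hn
  have hW : 0 < (scatter (frameSample z v₀)).det := by
    rw [det_scatter_frameSample hn hz hv₀.le]; linarith
  have hnear : ∀ᶠ v : Fin p → ℝ in 𝓝 v₀, n * (v ⬝ᵥ v) < 1 := by
    have : Continuous fun v : Fin p → ℝ => n * (v ⬝ᵥ v) :=
      continuous_const.mul (Continuous.dotProduct continuous_id continuous_id)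
    exact this.continuousAt.eventually (gt_mem_nhds hv₀)
  have hcoord (i : Fin p) : ∀ᵐ ω ∂μ, ((disp ω)⁻¹ *ᵥ ω.1) i = 0 := by
    have hplus : Tendsto (fun ε : ℝ => v₀ + ε • Pi.single i 1) (𝓝[>] 0) (𝓝 v₀) := by
      have : Continuous fun ε : ℝ => v₀ + ε • (Pi.single i 1 : Fin p → ℝ) := by fun_prop
      simpa using (this.tendsto 0).mono_left nhdsWithin_le_nhds
    have hminus : Tendsto (fun ε : ℝ => v₀ - ε • Pi.single i 1) (𝓝[>] 0) (𝓝 v₀) := by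
      have : Continuous fun ε : ℝ => v₀ - ε • (Pi.single i 1 : Fin p → ℝ) := by fun_prop
      simpa using (this.tendsto 0).mono_left nhdsWithin_le_nhds
    obtain ⟨ε, ⟨⟨hp1, hp2⟩, ⟨hm1, hm2⟩⟩, hε⟩ :=
      (((hplus.eventually (hmax.and hnear)).and (hminus.eventually (hmax.and hnear))).and
        self_mem_nhdsWithin).exists
    have hε : 0 < ε := hε
    obtain ⟨lik, hlik⟩ : ∃ lik : (Fin p → ℝ) → Param p → ℝ≥0∞, ∀ v, lik v = fun ω =>
        ENNReal.ofReal (likelihood ω.1 (disp ω) (frameSample z v)) := ⟨_, fun _ => rfl⟩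
    have hmeas (v : Fin p → ℝ) : Measurable (lik v) := by
      rw [hlik]
      exact (measurable_likelihood_param _).ennreal_ofReal
    have hmix (v : Fin p → ℝ) : ∫⁻ ω, lik v ω ∂μ = mix μ (frameSample z v) := by
      rw [hlik, mix]
    set s : Param p → ℝ := fun ω => n * (((disp ω)⁻¹ *ᵥ ω.1) ⬝ᵥ v₀) with hs
    set t : Param p → ℝ := fun ω => n * (ε * ((disp ω)⁻¹ *ᵥ ω.1) i) with ht
    have hsum : ∀ᵐ ω ∂μ, lik v₀ ω + lik v₀ ω =
        ENNReal.ofReal (2 * (weight n ω.1 (disp ω) * Real.exp (s ω))) ∧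
        lik (v₀ + ε • Pi.single i 1) ω + lik (v₀ - ε • Pi.single i 1) ω = ENNReal.ofReal
          (2 * (weight n ω.1 (disp ω) * Real.exp (s ω)) * Real.cosh (t ω)) := by
      filter_upwards [hμ] with ω hω
      have hw := weight_pos n ω.1 hω
      refine ⟨?_, ?_⟩
      · simp only [hlik]
        rw [likelihood_frameSample hn _ hω hz hv₀.le, ← ENNReal.ofReal_add (by positivity)
          (by positivity), two_mul]
      · simp only [hlik]
        rw [likelihood_frameSample hn _ hω hz hp2.le, likelihood_frameSample hn _ hω hz hm2.le,
          ← ENNReal.ofReal_add (by positivity) (by positivity), dotProduct_add, dotProduct_sub,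
          dotProduct_smul, dotProduct_single_one, smul_eq_mul, mul_add, mul_sub, Real.exp_add,
          Real.exp_sub, Real.cosh_eq, Real.exp_neg]
        congr 1
        ring
    have hae := ae_eq_of_ae_le_of_lintegral_le (μ := μ) (f := fun ω => lik v₀ ω + lik v₀ ω)
      (g := fun ω => lik (v₀ + ε • Pi.single i 1) ω + lik (v₀ - ε • Pi.single i 1) ω)
      (by
        filter_upwards [hsum, hμ] with ω hω hA
        have hw := weight_pos n ω.1 hA
        rw [hω.1, hω.2]
        exact ENNReal.ofReal_le_ofReal (le_mul_of_one_le_right (by positivity)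
          (Real.one_le_cosh _)))
      (by
        rw [lintegral_add_left (hmeas _), hmix]
        have := (mix_lt_top hn μ hμ hW).ne
        exact ENNReal.add_ne_top.2 ⟨this, this⟩)
      ((hmeas _).add (hmeas _)).aemeasurable
      (by
        rw [lintegral_add_left (hmeas _), lintegral_add_left (hmeas _), hmix, hmix,
          hmix]
        exact add_le_add hp1 hm1)
    filter_upwards [hsum, hμ, hae] with ω hω hA hEq
    have hw := weight_pos n ω.1 hA
    rw [hω.1, hω.2, ENNReal.ofReal_eq_ofReal_iff (by positivity)
      (mul_nonneg (by positivity) (Real.cosh_pos _).le)] at hEq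
    have hcosh : Real.cosh (t ω) = 1 := by
      have h0 : 2 * (weight n ω.1 (disp ω) * Real.exp (s ω)) ≠ 0 := by positivity
      exact (mul_left_cancel₀ h0 (by rw [mul_one]; exact hEq)).symm
    have ht0 : t ω = 0 := by
      by_contra h
      exact (Real.one_lt_cosh.2 h).ne' hcosh
    rw [ht] at ht0
    simpa [hn, hε.ne'] using ht0
  filter_upwards [ae_all_iff.2 hcoord, hμ] with ω hω hA
  have h0 : (disp ω)⁻¹ *ᵥ ω.1 = 0 := funext hω
  have := congrArg (disp ω *ᵥ ·) h0
  simpa [mulVec_mulVec, mul_nonsing_inv _ (isUnit_iff_ne_zero.2 hA.det_pos.ne')] using this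

/-! ### Analyticity along circles of means -/

/-- A uniformly bounded family of holomorphic functions may be integrated against a finite
measure: Cauchy's estimate bounds the derivatives. -/
theorem differentiableOn_integral_of_bounded {Ω : Type*} [MeasurableSpace Ω] (μ : Measure Ω)
    [IsFiniteMeasure μ] {U : Set ℂ} (hU : IsOpen U) {g : ℂ → Ω → ℂ} {M : ℝ}
    (hm : ∀ z, AEStronglyMeasurable (g z) μ)
    (hd : ∀ᵐ ω ∂μ, DifferentiableOn ℂ (fun z => g z ω) U)
    (hb : ∀ᵐ ω ∂μ, ∀ z ∈ U, ‖g z ω‖ ≤ M) :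
    DifferentiableOn ℂ (fun z => ∫ ω, g z ω ∂μ) U := by
  intro z₀ hz₀
  obtain ⟨ε, hε, hball⟩ := Metric.isOpen_iff.1 hU z₀ hz₀
  have hderiv : ∀ᵐ ω ∂μ, ∀ z ∈ U, HasDerivAt (fun z => g z ω) (deriv (fun z => g z ω) z) z := by
    filter_upwards [hd] with ω hω z hz
    exact (hω.differentiableAt (hU.mem_nhds hz)).hasDerivAt
  have hsub : Metric.ball z₀ (ε / 2) ⊆ U := (Metric.ball_subset_ball (by linarith)).trans hball
  refine (hasDerivAt_integral_of_dominated_loc_of_deriv_le (μ := μ) (F := g)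
    (F' := fun z ω => deriv (fun z => g z ω) z) (bound := fun _ => M / (ε / 4))
    (Metric.ball_mem_nhds z₀ (half_pos hε)) (Eventually.of_forall hm) ?_ ?_ ?_
    (integrable_const _) ?_).2.differentiableAt.differentiableWithinAt
  · exact Integrable.of_bound (hm z₀) M (hb.mono fun ω hω => hω z₀ hz₀)
  · -- the derivative is a limit of difference quotients, hence measurable
    refine aestronglyMeasurable_of_tendsto_ae (𝓝[≠] z₀)
      (f := fun z ω => slope (fun z => g z ω) z₀ z) (fun z => ?_) ?_
    · simp only [slope_def_field]
      exact ((hm z).sub (hm z₀)).mul aestronglyMeasurable_const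
    · filter_upwards [hderiv] with ω hω
      exact hasDerivAt_iff_tendsto_slope.1 (hω z₀ hz₀)
  · filter_upwards [hd, hb] with ω hω hbω z hz
    have hcb : Metric.closedBall z (ε / 4) ⊆ U := by
      intro y hy
      refine hball ?_
      rw [Metric.mem_ball] at hz ⊢
      rw [Metric.mem_closedBall] at hy
      have := dist_triangle y z z₀
      linarith
    refine Complex.norm_deriv_le_of_forall_mem_sphere_norm_le (by linarith)
      ((hω.mono hcb).diffContOnCl_ball subset_rfl) fun y hy =>
        hbω y (hcb (Metric.sphere_subset_closedBall hy))
  · filter_upwards [hderiv] with ω hω z hz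
    exact hω z (hsub hz)

theorem measurable_inv_mulVec_dotProduct {p : ℕ} (d : Fin p → ℝ) :
    Measurable fun ω : Param p => ((disp ω)⁻¹ *ᵥ ω.1) ⬝ᵥ d := by
  have hinv := measurable_inv_apply (measurable_snd : Measurable fun ω : Param p => ω.2)
  have hfst (i : Fin p) : Measurable fun ω : Param p => ω.1 i :=
    (measurable_pi_apply i).comp measurable_fst
  simp only [dotProduct, mulVec, disp]
  exact Finset.measurable_sum _ fun i _ => (Finset.measurable_sum _ fun k _ =>
    (hinv i k).mul (hfst k)).mul_const _

theorem measurable_weight (n : ℕ) {p : ℕ} :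
    Measurable fun ω : Param p => weight n ω.1 (disp ω) := by
  have hinv := measurable_inv_apply (measurable_snd : Measurable fun ω : Param p => ω.2)
  have hdet := measurable_det (measurable_snd : Measurable fun ω : Param p => ω.2)
  have hq := measurable_normSq (measurable_snd : Measurable fun ω : Param p => ω.2) measurable_fst
  have htr : Measurable fun ω : Param p => (Matrix.of ω.2)⁻¹.trace := by
    simp only [trace, diag_apply]
    exact Finset.measurable_sum _ fun i _ => hinv i i
  simp only [weight, disp]
  exact ((hdet.const_mul _).sqrt.inv.pow_const n).mul
    ((htr.add (hq.const_mul _)).const_mul _).exp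

/-- The circle of radius `r` in the plane spanned by the orthonormal vectors `d` and `w`,
parametrized by the angle. -/
def circle {p : ℕ} (r : ℝ) (d w : Fin p → ℝ) (t : ℝ) : Fin p → ℝ :=
  (r * Real.cos t) • d + (r * Real.sin t) • w

theorem circle_dotProduct_self {p : ℕ} (r : ℝ) {d w : Fin p → ℝ} (hd : d ⬝ᵥ d = 1)
    (hw : w ⬝ᵥ w = 1) (hdw : d ⬝ᵥ w = 0) (t : ℝ) : circle r d w t ⬝ᵥ circle r d w t = r ^ 2 := by
  simp only [circle, add_dotProduct, dotProduct_add, smul_dotProduct, dotProduct_smul, smul_eq_mul,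
    hd, hw, hdw, dotProduct_comm w d]
  linear_combination r ^ 2 * Real.sin_sq_add_cos_sq t

/-- On samples whose second moment matrix is the identity and whose mean moves along a circle, a
mixture of likelihoods is an integral of exponentials of trigonometric polynomials, and those
extend to a strip around the real axis. There the extended integrand is bounded by the likelihood at
a mean of the larger norm `r cosh (Im ζ)`. -/
theorem analyticAt_mix_circle {n p : ℕ} (hn : n ≠ 0) (μ : Measure (Param p)) [IsFiniteMeasure μ]
    (hμ : ∀ᵐ ω ∂μ, (disp ω).PosDef) {z : Sample n p} (hz : IsCenteredFrame z) {r : ℝ}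
    (hr : n * r ^ 2 < 1) {d w : Fin p → ℝ} (hd : d ⬝ᵥ d = 1) (hw : w ⬝ᵥ w = 1)
    (hdw : d ⬝ᵥ w = 0) (t : ℝ) :
    AnalyticAt ℝ (fun t => (mix μ (frameSample z (circle r d w t))).toReal) t := by
  obtain ⟨ρ, hρ1, hρ2⟩ := exists_between hr
  set a : Param p → ℝ := fun ω => ((disp ω)⁻¹ *ᵥ ω.1) ⬝ᵥ d with ha
  set b : Param p → ℝ := fun ω => ((disp ω)⁻¹ *ᵥ ω.1) ⬝ᵥ w with hb
  have ham : Measurable a := measurable_inv_mulVec_dotProduct d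
  have hbm : Measurable b := measurable_inv_mulVec_dotProduct w
  have hwm := measurable_weight n (p := p)
  set g : ℂ → Param p → ℂ := fun ζ ω => (weight n ω.1 (disp ω) : ℂ) *
    Complex.exp (n * r * (a ω * Complex.cos ζ + b ω * Complex.sin ζ)) with hg
  set U : Set ℂ := {ζ | n * (r * Real.cosh ζ.im) ^ 2 < ρ} with hU
  have hUo : IsOpen U := by
    refine isOpen_lt ?_ continuous_const
    have := Real.continuous_cosh.comp Complex.continuous_im
    fun_prop
  have htU : (t : ℂ) ∈ U := by simpa [hU] using hρ1
  have hnorm (ζ : ℂ) (ω : Param p) : ‖g ζ ω‖ = |weight n ω.1 (disp ω)| * Real.exp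
      (n * (((disp ω)⁻¹ *ᵥ ω.1) ⬝ᵥ circle (r * Real.cosh ζ.im) d w ζ.re)) := by
    simp only [hg, norm_mul, Complex.norm_real, Real.norm_eq_abs, Complex.norm_exp]
    congr 2
    have hc : (Complex.cos ζ).re = Real.cos ζ.re * Real.cosh ζ.im := by
      have : Complex.cos ζ = ((Real.cos ζ.re * Real.cosh ζ.im : ℝ) : ℂ) -
          ((Real.sin ζ.re * Real.sinh ζ.im : ℝ) : ℂ) * Complex.I := by
        rw [Complex.cos_eq]; push_cast; rfl
      rw [this, Complex.sub_re, Complex.ofReal_re, Complex.re_ofReal_mul, Complex.I_re, mul_zero,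
        sub_zero]
    have hs : (Complex.sin ζ).re = Real.sin ζ.re * Real.cosh ζ.im := by
      have : Complex.sin ζ = ((Real.sin ζ.re * Real.cosh ζ.im : ℝ) : ℂ) +
          ((Real.cos ζ.re * Real.sinh ζ.im : ℝ) : ℂ) * Complex.I := by
        rw [Complex.sin_eq]; push_cast; rfl
      rw [this, Complex.add_re, Complex.ofReal_re, Complex.re_ofReal_mul, Complex.I_re, mul_zero,
        add_zero]
    have : (n * r * (a ω * Complex.cos ζ + b ω * Complex.sin ζ) : ℂ).re =
        n * r * (a ω * (Complex.cos ζ).re + b ω * (Complex.sin ζ).re) := by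
      have : (n * r : ℂ) = ((n * r : ℝ) : ℂ) := by push_cast; rfl
      rw [this, Complex.re_ofReal_mul, Complex.add_re, Complex.re_ofReal_mul,
        Complex.re_ofReal_mul]
    rw [this, hc, hs, circle, dotProduct_add, dotProduct_smul, dotProduct_smul]
    simp only [smul_eq_mul, ha, hb]
    ring
  have hdiff : DifferentiableOn ℂ (fun ζ => ∫ ω, g ζ ω ∂μ) U := by
    refine differentiableOn_integral_of_bounded μ hUo
      (M := peak n p * (Real.sqrt (1 - ρ))⁻¹ ^ n) (fun ζ => ?_) ?_ ?_
    · refine Measurable.aestronglyMeasurable ?_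
      simp only [hg]
      fun_prop
    · refine Eventually.of_forall fun ω => ?_
      simp only [hg]
      fun_prop
    · filter_upwards [hμ] with ω hω ζ hζ
      have hζ' : n * (circle (r * Real.cosh ζ.im) d w ζ.re ⬝ᵥ
          circle (r * Real.cosh ζ.im) d w ζ.re) < ρ := by
        rw [circle_dotProduct_self _ hd hw hdw]
        exact hζ
      have hdet := det_scatter_frameSample hn hz (hζ'.trans hρ2).le
      have hpos : 0 < (scatter (frameSample z (circle (r * Real.cosh ζ.im) d w ζ.re))).det := by
        rw [hdet]; linarith
      have hle := det_scatter_le_det_scatterAbout hn ω.1 hpos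
      rw [hnorm, abs_of_pos (weight_pos n _ hω),
        ← likelihood_frameSample hn _ hω hz (hζ'.trans hρ2).le]
      refine (likelihood_le hn _ hω (hpos.trans_le hle)).trans ?_
      have := peak_pos p hn
      have : 0 < Real.sqrt (1 - ρ) := Real.sqrt_pos.2 (by linarith)
      have : 1 - ρ ≤ (scatterAbout ω.1
          (frameSample z (circle (r * Real.cosh ζ.im) d w ζ.re))).det := by
        refine le_trans ?_ hle
        rw [hdet]; linarith
      gcongr
  have hre := (hdiff.analyticAt (hUo.mem_nhds htU)).re_ofReal
  refine hre.congr (Eventually.of_forall fun t => ?_)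
  have hcirc : n * (circle r d w t ⬝ᵥ circle r d w t) ≤ 1 := by
    rw [circle_dotProduct_self _ hd hw hdw]
    exact hr.le
  have hint : ∫ ω, g t ω ∂μ =
      ∫ ω, ((likelihood ω.1 (disp ω) (frameSample z (circle r d w t)) : ℝ) : ℂ) ∂μ := by
    refine integral_congr_ae (hμ.mono fun ω hω => ?_)
    simp only [hg]
    rw [likelihood_frameSample hn _ hω hz hcirc, circle, dotProduct_add, dotProduct_smul,
      dotProduct_smul]
    simp only [smul_eq_mul, ha, hb]
    push_cast
    congr 2
    ring
  simp only [hint]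
  rw [integral_complex_ofReal, Complex.ofReal_re, integral_eq_lintegral_of_nonneg_ae
    (Eventually.of_forall fun ω => likelihood_nonneg _ _ _)
    (measurable_likelihood_param _).aestronglyMeasurable, mix]

theorem continuous_circle {p : ℕ} (r : ℝ) (d w : Fin p → ℝ) : Continuous (circle r d w) := by
  unfold circle; fun_prop

/-! ### Ratio tests are not proper Bayes -/

/-- On the boundary hypersurface of a ratio test, at a sample whose mean lies in the interior of
the cone, the two weighted mixture densities of a Bayes problem solved by the test agree: the
sample is a limit of interior points of the rejection region and of the acceptance region, both
reached by rescaling the mean. -/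
theorem eq_of_isRatioTest {n p : ℕ} (hn : n ≠ 0) {I : Set (Fin p)} {κ : ℝ}
    {φ : Sample n p → ℝ≥0∞} (hφ : IsRatioTest (signCone I) κ φ) {z : Sample n p}
    (hz : IsCenteredFrame z) {f g : Sample n p → ℝ≥0∞}
    (hf : ∀ x, 0 < (scatter x).det → ContinuousAt f x)
    (hg : ∀ x, 0 < (scatter x).det → ContinuousAt g x)
    (hae : ∀ᵐ x, (φ x = 1 → f x ≤ g x) ∧ (φ x = 0 → g x ≤ f x)) {v : Fin p → ℝ}
    (hv : ∀ i, 0 < v i) (hv0 : 0 < v ⬝ᵥ v) (hκ : 1 < κ) (hvκ : κ * (1 - n * (v ⬝ᵥ v)) = 1) :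
    f (frameSample z v) = g (frameSample z v) := by
  have hn' : (0 : ℝ) < n := by exact_mod_cast Nat.pos_of_ne_zero hn
  have hnv : n * (v ⬝ᵥ v) < 1 := by
    by_contra! h
    nlinarith
  have hpos : 0 < (scatter (frameSample z v)).det := by
    rw [det_scatter_frameSample hn hz hnv.le]; linarith
  have hcont : Continuous fun c : ℝ => frameSample z (c • v) :=
    (continuous_frameSample z).comp (by fun_prop)
  have htend : Tendsto (fun c : ℝ => frameSample z (c • v)) (𝓝 1) (𝓝 (frameSample z v)) := by
    simpa using hcont.tendsto 1
  have hsmul (c : ℝ) : (c • v) ⬝ᵥ (c • v) = c ^ 2 * (v ⬝ᵥ v) := by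
    rw [smul_dotProduct, dotProduct_smul, smul_eq_mul, smul_eq_mul]; ring
  have hsmall : ∀ᶠ c : ℝ in 𝓝 1, n * ((c • v) ⬝ᵥ (c • v)) < 1 ∧ 0 < c := by
    have h1 : Continuous fun c : ℝ => n * ((c • v) ⬝ᵥ (c • v)) := by
      simp only [hsmul]; fun_prop
    exact (h1.continuousAt.eventually (gt_mem_nhds (by simpa using hnv))).and
      (lt_mem_nhds one_pos)
  have hdet : Continuous fun x : Sample n p => κ * (scatter x).det :=
    continuous_const.mul continuous_scatter.matrix_det
  have hdet0 := (continuous_scatterAbout (n := n) (p := p) 0).matrix_det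
  refine le_antisymm ?_ ?_
  · refine le_of_frequently_eventually (hae.mono fun x hx => hx.1) (hf _ hpos) (hg _ hpos) ?_
    refine (htend.mono_left (nhdsWithin_le_nhds (s := Set.Ioi 1))).frequently
      (Eventually.frequently ?_)
    filter_upwards [nhdsWithin_le_nhds hsmall, self_mem_nhdsWithin] with c hc hc1
    have hc1 : 1 < c := hc1
    have hd := det_scatter_frameSample hn hz hc.1.le
    have hcpos : 0 < (scatter (frameSample z (c • v))).det := by rw [hd]; linarith [hc.1]
    have hlt : κ * (scatter (frameSample z (c • v))).det <
        (scatterAbout 0 (frameSample z (c • v))).det := by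
      rw [hd, scatterAbout_zero_frameSample hz hc.1.le, det_one, hsmul]
      have hc2 : 1 < c ^ 2 := one_lt_pow₀ hc1 two_ne_zero
      have : n * (v ⬝ᵥ v) < n * (c ^ 2 * (v ⬝ᵥ v)) :=
        mul_lt_mul_of_pos_left (lt_mul_of_one_lt_left hv0 hc2) hn'
      refine lt_of_lt_of_eq ?_ hvκ
      gcongr
    have hmean : ∀ᶠ y in 𝓝 (frameSample z (c • v)), ∀ i, 0 < sampleMean y i := by
      refine eventually_all.2 fun i => ?_
      refine (((continuous_apply i).comp continuous_sampleMean).continuousAt).eventually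
        (lt_mem_nhds ?_)
      simp only [Function.comp_apply, sampleMean_frameSample hn hz, Pi.smul_apply, smul_eq_mul]
      exact mul_pos hc.2 (hv i)
    filter_upwards [eventually_det_scatter_pos hcpos, hmean,
      hdet.continuousAt.eventually_lt hdet0.continuousAt hlt] with y h1 h2 h3
    exact hφ.reject y h1 (fun i _ => (h2 i).le) h3.le
  · refine le_of_frequently_eventually (hae.mono fun x hx => hx.2) (hg _ hpos) (hf _ hpos) ?_
    refine (htend.mono_left (nhdsWithin_le_nhds (s := Set.Iio 1))).frequently
      (Eventually.frequently ?_)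
    filter_upwards [nhdsWithin_le_nhds hsmall, self_mem_nhdsWithin] with c hc hc1
    have hc1 : c < 1 := hc1
    have hd := det_scatter_frameSample hn hz hc.1.le
    have hcpos : 0 < (scatter (frameSample z (c • v))).det := by rw [hd]; linarith [hc.1]
    have hlt : (scatterAbout 0 (frameSample z (c • v))).det <
        κ * (scatter (frameSample z (c • v))).det := by
      rw [hd, scatterAbout_zero_frameSample hz hc.1.le, det_one, hsmul]
      have hc2 : c ^ 2 < 1 := pow_lt_one₀ hc.2.le hc1 two_ne_zero
      have : n * (c ^ 2 * (v ⬝ᵥ v)) < n * (v ⬝ᵥ v) :=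
        mul_lt_mul_of_pos_left (mul_lt_of_lt_one_left hv0 hc2) hn'
      refine hvκ.symm.trans_lt ?_
      gcongr
    filter_upwards [eventually_det_scatter_pos hcpos,
      hdet0.continuousAt.eventually_lt hdet.continuousAt hlt] with y h1 h3
    exact hφ.accept y h1 h3

theorem exists_orthonormal_pair {p : ℕ} (hp : 2 ≤ p) : ∃ d w : Fin p → ℝ,
    d ⬝ᵥ d = 1 ∧ w ⬝ᵥ w = 1 ∧ d ⬝ᵥ w = 0 ∧ ∀ i, 0 < d i := by
  have hp0 : (0 : ℝ) < p := by exact_mod_cast (by lia : 0 < p)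
  let i₀ : Fin p := ⟨0, by lia⟩
  let i₁ : Fin p := ⟨1, by lia⟩
  have hne : i₀ ≠ i₁ := by simp [i₀, i₁, Fin.ext_iff]
  refine ⟨fun _ => (Real.sqrt p)⁻¹, (Real.sqrt 2)⁻¹ • (Pi.single i₀ 1 - Pi.single i₁ 1),
    ?_, ?_, ?_, fun i => by positivity⟩
  · simp only [dotProduct, Finset.sum_const, Finset.card_univ, Fintype.card_fin, nsmul_eq_mul]
    field_simp
    rw [Real.sq_sqrt hp0.le]
  · have h2 : (Real.sqrt 2)⁻¹ * (Real.sqrt 2)⁻¹ = 1 / 2 := by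
      rw [← mul_inv, Real.mul_self_sqrt (by norm_num)]; norm_num
    simp only [smul_dotProduct, dotProduct_smul, sub_dotProduct, dotProduct_sub,
      single_one_dotProduct, smul_eq_mul, Pi.single_eq_same, Pi.single_eq_of_ne hne,
      Pi.single_eq_of_ne hne.symm]
    linear_combination 2 * h2
  · simp [dotProduct_smul, dotProduct_sub]

/-- A ratio test is not a proper Bayes test. -/
theorem IsRatioTest.not_isProperBayes {n p : ℕ} (hp : 2 ≤ p) (hn : p < n) {I : Set (Fin p)}
    (hI : I.Nonempty) {κ : ℝ} (hκ : 1 < κ) {φ : Sample n p → ℝ≥0∞} (hφt : IsTest φ)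
    (hφ : IsRatioTest (signCone I) κ φ) : ¬ IsProperBayes (signCone I) φ := by
  rintro ⟨G, hGprob, hG, a, b, ha, hb, hmin⟩
  have hn0 : n ≠ 0 := by lia
  have hn' : (0 : ℝ) < n := by exact_mod_cast Nat.pos_of_ne_zero hn0
  have hκ0 : 0 < κ := by linarith
  have hGA : ∀ᵐ ω ∂G, (disp ω).PosDef := hG.mono fun ω hω => hω.2
  have hG0 : ∀ᵐ ω ∂(nullPart G), (disp ω).PosDef := ae_restrict_of_ae hGA
  have hG1 : ∀ᵐ ω ∂(altPart G), (disp ω).PosDef := ae_restrict_of_ae hGA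
  obtain ⟨z, hz⟩ := exists_isCenteredFrame hn
  obtain ⟨d, w, hd, hw, hdw, hdpos⟩ := exists_orthonormal_pair hp
  set f₀ : Sample n p → ℝ≥0∞ := fun x => a * mix (nullPart G) x with hf₀
  set f₁ : Sample n p → ℝ≥0∞ := fun x => b * mix (altPart G) x with hf₁
  have hae : ∀ᵐ x, (φ x = 1 → f₀ x ≤ f₁ x) ∧ (φ x = 0 → f₁ x ≤ f₀ x) :=
    ae_of_averageRisk_le G hGA a b hφt hmin
  have hc₀ (x : Sample n p) (hx : 0 < (scatter x).det) : ContinuousAt f₀ x :=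
    (ENNReal.continuous_const_mul ENNReal.coe_ne_top).continuousAt.comp
      (continuousAt_mix hn0 _ hG0 hx)
  have hc₁ (x : Sample n p) (hx : 0 < (scatter x).det) : ContinuousAt f₁ x :=
    (ENNReal.continuous_const_mul ENNReal.coe_ne_top).continuousAt.comp
      (continuousAt_mix hn0 _ hG1 hx)
  -- the radius at which the determinant ratio equals `κ`
  obtain ⟨r, hr0, hr⟩ : ∃ r : ℝ, 0 < r ∧ κ * (1 - n * r ^ 2) = 1 := by
    have : 0 < (1 - κ⁻¹) / n := div_pos (sub_pos.2 (inv_lt_one_of_one_lt₀ hκ)) hn'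
    refine ⟨Real.sqrt ((1 - κ⁻¹) / n), Real.sqrt_pos.2 this, ?_⟩
    rw [Real.sq_sqrt this.le]
    field_simp
    ring
  have hr1 : n * r ^ 2 < 1 := by
    by_contra! h
    nlinarith
  set y : ℝ → Sample n p := fun t => frameSample z (circle r d w t) with hy
  have hcirc (t : ℝ) : n * (circle r d w t ⬝ᵥ circle r d w t) < 1 := by
    rwa [circle_dotProduct_self _ hd hw hdw]
  have hydet (t : ℝ) : 0 < (scatter (y t)).det := by
    rw [hy, det_scatter_frameSample hn0 hz (hcirc t).le]
    linarith [hcirc t]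
  have hconst (v : Fin p → ℝ) (hv : n * (v ⬝ᵥ v) ≤ 1) : f₀ (frameSample z v) = f₀ (y 0) := by
    simp only [hf₀]
    rw [mix_nullPart_congr G ((scatterAbout_zero_frameSample hz hv).trans
      (scatterAbout_zero_frameSample hz (hcirc 0).le).symm)]
  -- equality of the weighted densities propagates around the circle
  have hnear : ∀ᶠ t in 𝓝 (0 : ℝ), f₁ (y t) = f₀ (y 0) := by
    have hpos : ∀ᶠ t in 𝓝 (0 : ℝ), ∀ i, 0 < circle r d w t i := by
      refine eventually_all.2 fun i => ?_
      refine (((continuous_apply i).comp (continuous_circle r d w)).continuousAt).eventually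
        (lt_mem_nhds ?_)
      simpa [circle] using mul_pos hr0 (hdpos i)
    filter_upwards [hpos] with t ht
    rw [← hconst _ (hcirc t).le]
    refine (eq_of_isRatioTest hn0 hφ hz hc₀ hc₁ hae ht ?_ hκ ?_).symm
    · rw [circle_dotProduct_self _ hd hw hdw]; positivity
    · rwa [circle_dotProduct_self _ hd hw hdw]
  have hall : (fun t => (f₁ (y t)).toReal) = fun _ => (f₀ (y 0)).toReal := by
    refine AnalyticOnNhd.eq_of_eventuallyEq (𝕜 := ℝ) (z₀ := 0) (fun t _ => ?_)
      (fun t _ => analyticAt_const) (hnear.mono fun t ht => congrArg ENNReal.toReal ht)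
    simp only [hf₁, ENNReal.toReal_mul]
    exact analyticAt_const.mul (analyticAt_mix_circle hn0 _ hG1 hz hr1 hd hw hdw t)
  have hfin₀ : f₀ (y 0) ≠ ∞ :=
    ENNReal.mul_ne_top ENNReal.coe_ne_top (mix_lt_top hn0 _ hG0 (hydet 0)).ne
  have hfin₁ (t : ℝ) : f₁ (y t) ≠ ∞ :=
    ENNReal.mul_ne_top ENNReal.coe_ne_top (mix_lt_top hn0 _ hG1 (hydet t)).ne
  have hπ : f₁ (y Real.pi) = f₀ (y 0) :=
    (ENNReal.toReal_eq_toReal_iff' (hfin₁ _) hfin₀).1 (congrFun hall Real.pi)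
  -- near the antipode the test accepts, so the alternative density has a local maximum there
  have hout : ∀ᶠ x in 𝓝 (y Real.pi), φ x = 0 := by
    refine hφ.accept_outside _ (hydet _) ?_ ?_
    · rw [hy, sampleMean_frameSample hn0 hz]
      intro hmem
      obtain ⟨i, hi⟩ := hI
      have := hmem i hi
      simp only [circle, Real.cos_pi, Real.sin_pi, Pi.add_apply, Pi.smul_apply, smul_eq_mul] at this
      have := mul_pos hr0 (hdpos i)
      linarith
    · rw [hy, scatterAbout_zero_frameSample hz (hcirc _).le,
        det_scatter_frameSample hn0 hz (hcirc _).le, circle_dotProduct_self _ hd hw hdw, hr,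
        det_one]
  have hle : ∀ᶠ x in 𝓝 (y Real.pi), f₁ x ≤ f₀ x := by
    filter_upwards [eventually_eventually_nhds.2 (eventually_eventually_nhds.2 hout),
      eventually_det_scatter_pos (hydet Real.pi)] with x hx hxd
    exact le_of_frequently_eventually (hae.mono fun x hx => hx.2) (hc₁ x hxd) (hc₀ x hxd)
      hx.frequently
  have hmax : ∀ᶠ v in 𝓝 (circle r d w Real.pi), mix (altPart G) (frameSample z v) ≤
      mix (altPart G) (frameSample z (circle r d w Real.pi)) := by
    have hcv : Continuous fun v : Fin p → ℝ => n * (v ⬝ᵥ v) :=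
      continuous_const.mul (Continuous.dotProduct continuous_id continuous_id)
    filter_upwards [(continuous_frameSample z).continuousAt.eventually hle,
      hcv.continuousAt.eventually (gt_mem_nhds (hcirc Real.pi))] with v hv hv1
    rw [hconst v hv1.le, ← hπ] at hv
    exact (ENNReal.mul_le_mul_iff_right (ENNReal.coe_ne_zero.2 hb.ne') ENNReal.coe_ne_top).1 hv
  have hzero := ae_eq_zero_of_eventually_le hn0 (altPart G) hG1 hz (hcirc Real.pi) hmax
  have halt : altPart G = 0 := by
    have hne : ∀ᵐ ω ∂(altPart G), ω.1 ≠ 0 := ae_restrict_mem measurableSet_null.compl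
    rw [← ae_eq_bot, ← eventually_false_iff_eq_bot]
    filter_upwards [hzero, hne] with ω h h' using h' h
  have hnull : nullPart G = 0 := by
    have h0 : mix (nullPart G) (y 0) = 0 := by
      have : f₀ (y 0) = 0 := by rw [← hπ]; simp [hf₁, halt, mix]
      exact (mul_eq_zero.1 this).resolve_left (ENNReal.coe_ne_zero.2 ha.ne')
    rw [mix, lintegral_eq_zero_iff (measurable_likelihood_param _).ennreal_ofReal] at h0
    rw [← ae_eq_bot, ← eventually_false_iff_eq_bot]
    filter_upwards [h0, hG0] with ω h hA
    exact (ENNReal.ofReal_pos.2 (likelihood_pos ω.1 hA (y 0))).ne' h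
  have : G = 0 := by
    rw [← Measure.restrict_add_restrict_compl (μ := G) measurableSet_null]
    change nullPart G + altPart G = 0
    rw [hnull, halt, add_zero]
  exact IsProbabilityMeasure.ne_zero G this

theorem exists_eq_signCone {p : ℕ} (hp : 0 < p) {C : Set (Fin p → ℝ)}
    (hC : C = orthant p ∨ C = halfSpace p) : ∃ I : Set (Fin p), I.Nonempty ∧ C = signCone I := by
  rcases hC with rfl | rfl
  · refine ⟨Set.univ, ⟨⟨0, hp⟩, trivial⟩, ?_⟩
    ext θ
    exact ⟨fun h i _ => h i, fun h i => h i trivial⟩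
  · refine ⟨{i | (i : ℕ) + 1 = p}, ⟨⟨p - 1, by lia⟩, ?_⟩, rfl⟩
    change p - 1 + 1 = p
    lia

end OrderRestricted

end

theorem theorem3p2 (p n : ℕ) (hp : 2 ≤ p) (hn : p < n) (C : Set (Fin p → ℝ))
    (hC : C = OrderRestricted.orthant p ∨ C = OrderRestricted.halfSpace p) :
    (∀ k : ℝ, 1 < k →
      OrderRestricted.IsTest (OrderRestricted.lrt (n := n) C k) ∧
        ¬ OrderRestricted.IsProperBayes C (OrderRestricted.lrt (n := n) C k)) ∧
    (∀ l : ℝ, 0 < l →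
      OrderRestricted.IsTest (OrderRestricted.testL (n := n) C l) ∧
        ¬ OrderRestricted.IsProperBayes C (OrderRestricted.testL (n := n) C l)) := by
  obtain ⟨I, hI, rfl⟩ := OrderRestricted.exists_eq_signCone (by lia) hC
  refine ⟨fun k hk => ?_, fun l hl => ?_⟩
  · obtain ⟨κ, hκ, h⟩ := OrderRestricted.isRatioTest_lrt (n := n) (by lia) I hk
    have ht := OrderRestricted.isTest_lrt (n := n) (OrderRestricted.signCone I) k
    exact ⟨ht, h.not_isProperBayes hp hn hI hκ ht⟩
  · obtain ⟨κ, hκ, h⟩ := OrderRestricted.isRatioTest_testL (n := n) (by lia) I hl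
    have ht := OrderRestricted.isTest_testL (n := n) (OrderRestricted.signCone I) l
    exact ⟨ht, h.not_isProperBayes hp hn hI hκ ht⟩
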